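/- **Setting.** There are $n\ge 1$ agents. Agent $i$ has a convex compact set $\mathcal Y_i\subset\mathbb R^{p_i}$ of positive diameter and a function $f_i(x,y)$, $x\in\mathbb R^d$, $y\in\mathbb R^{p_i}$, which is differentiable at the points of $\mathbb R^d\times\mathcal Y_i$. For all $x,x'\in\mathbb R^d$ and $y,y'\in\mathcal Y_i$, $$\|\nabla f_i(x,y)-\nabla f_i(x',y')\|\le L(\|x-x'\|+\|y-y'\|),\qquad f_i(x,y)\le f_i(x,y')+\langle\nabla_y f_i(x,y'),y-y'\rangle-\tfrac{\mu}{2}\|y-y'\|^2,$$ where $\mu>0$. Put $\kappa=L/\mu$, $\hat y_i(x)=\arg\max_{y\in\mathcal Y_i}f_i(x,y)$ and $\Phi(x)=\frac1n\sum_{i=1}^n\max_{y\in\mathcal Y_i}f_i(x,y)$, and let $\Phi^*\in\mathbb R$ be a lower bound of $\Phi$. The mixing matrix $W=[w_{ij}]\in\mathbb R^{n\times n}$ is nonnegative, symmetric and satisfies $W\mathbf 1=\mathbf 1$. It is compatible with a connected undirected graph on the agents: for $i\ne j$, $w_{ij}=w_{ji}>0$ if $i,j$ are linked, and $w_{ij}=w_{ji}=0$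 otherwise. Let $\lambda$ be the spectral norm of $W-\mathbf 1\mathbf 1^{T}/n$. The random samples $\xi_{i,j}^t$ ($t\ge 0$, $1\le i\le n$, $1\le j\le b$, with batch size $b\ge1$) are mutually independent. The stochastic gradient $h_i=(h_{x,i},h_{y,i})$ is jointly measurable, and for every sample $\xi=\xi_{i,j}^t$, every $x\in\mathbb R^d$ and every $y\in\mathcal Y_i$, $h_i(x,y,\xi)$ is square integrable with $$\mathbb E\,h_i(x,y,\xi)=\nabla f_i(x,y),\qquad \mathbb E\|h_i(x,y,\xi)-\nabla f_i(x,y)\|^2\le\sigma^2 .$$ **Algorithm (DSGTA).** Let $\underline h_i^t=(\underline h_{x,i}^t,\underline h_{y,i}^t)=\frac1b\sum_{j=1}^b h_i(x_i^t,y_i^t,\xi_{i,j}^t)$. Start from deterministic $x_i^0\in\mathbb R^d$, $y_i^0\in\mathcal Y_i$, with $g_i^0=\underline h_{x,i}^0$, and for $t\ge0$ set $$x_i^{t+1}=\sum_j w_{ij}(x_j^t-\eta_x g_j^t),\quad y_i^{t+1}=\mathrm{Proj}_{\mathcal Y_i}(y_i^t+\eta_y\underline h_{y,i}^t),\quad g_i^{t+1}=\sum_j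 w_{ij}(g_j^t+\underline h_{x,j}^{t+1}-\underline h_{x,j}^t).$$ **Lyapunov function.** Write $\bar x^t=\frac1n\sum_i x_i^t$, $\bar g^t=\frac1n\sum_i g_i^t$ and $\delta^t=\sum_{i}\|\hat y_i(\bar x^t)-y_i^t\|^2$, and define $$\mathcal L^t=\Phi(\bar x^t)-\Phi^*+\frac{300\kappa^2L^2\eta_x}{n(1-\lambda^2)}\sum_{i}\|x_i^t-\bar x^t\|^2+\frac{8\eta_xL^2}{n\eta_y\mu}\delta^t+\frac{2400\eta_x^3\kappa^2L^2}{n(1-\lambda^2)^3}\sum_{i}\|g_i^t-\bar g^t\|^2 .$$ **Lemma.** Let the stepsizes $\eta_x,\eta_y>0$ satisfy $$\eta_y\le\frac{\sqrt{1-\lambda^2}}{9(L+\mu)},\qquad \eta_x\le\min\left\{\frac{(1-\lambda^2)^2}{120\sqrt3\,\kappa L},\ \frac{\eta_y}{8\sqrt6\,\kappa^2},\ \frac{(\eta_y\mu)^{1/4}(1-\lambda^2)}{50\kappa L}\right\}.$$ Then $\Phi$ is differentiable, $\mathcal L^t$ and $\|\nabla\Phi(\bar x^t)\|^2$ are integrable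 for every $t\ge0$, and for every $t\ge 0$ $$\mathbb E\mathcal L^{t+1}\le\mathbb E\mathcal L^t-\frac{\eta_x}{2}\mathbb E\|\nabla\Phi(\bar x^t)\|^2+\frac{\eta_x^2L\kappa\sigma^2}{nb}+\frac{24\eta_x\eta_y\kappa L\sigma^2}{b}+\left[\frac{1}{n\eta_y^2\mu^2}+\frac{225}{(1-\lambda^2)^3}+\frac{54\eta_x^2\kappa^2L^2}{n(1-\lambda^2)\eta_y\mu}\right]\frac{32\eta_x^3\kappa^2L^2\sigma^2}{b}.$$ -/

import Mathlib

open MeasureTheory ProbabilityTheory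

noncomputable section

namespace DSGTA

/-- The Euclidean space `ℝᵏ`. -/
abbrev Vec (k : ℕ) : Type := EuclideanSpace ℝ (Fin k)

/-- The product `ℝᵈ × ℝᵏ` with the Euclidean norm `‖(u, v)‖² = ‖u‖² + ‖v‖²`. -/
abbrev Pair (d k : ℕ) : Type := WithLp 2 (Vec d × Vec k)

/-- The full gradient `∇φ(x, y) = (∇ₓφ(x, y), ∇_yφ(x, y))`. -/
def fullGrad {d k : ℕ} (φ : Vec d → Vec k → ℝ) (x : Vec d) (y : Vec k) : Pair d k :=
  gradient (fun q : Pair d k => φ q.fst q.snd) (WithLp.toLp 2 (x, y))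

/-- `max_{y ∈ Y} φ(x, y)` as a function of `x`. -/
def maxValue {d k : ℕ} (φ : Vec d → Vec k → ℝ) (Y : Set (Vec k)) (x : Vec d) : ℝ :=
  sSup ((fun y => φ x y) '' Y)

/-- A maximizer of `φ(x, ·)` over `Y` (the only one if `φ(x, ·)` is strongly concave and `Y` is
convex and compact). -/
def argmaxOn {d k : ℕ} (φ : Vec d → Vec k → ℝ) (Y : Set (Vec k)) (x : Vec d) : Vec k :=
  Classical.epsilon fun y => y ∈ Y ∧ IsMaxOn (fun z => φ x z) Y y

/-- The Euclidean projection of `u` onto `Y` (the only nearest point if `Y` is convex, closed and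
nonempty). -/
def proj {k : ℕ} (Y : Set (Vec k)) (u : Vec k) : Vec k :=
  Classical.epsilon fun y => y ∈ Y ∧ IsMinOn (fun z => dist u z) Y y

/-- The average `v̄ = (1/n) ∑ᵢ vᵢ`. -/
def avg {n d : ℕ} (v : Fin n → Vec d) : Vec d := (n : ℝ)⁻¹ • ∑ i, v i

/-- The squared Frobenius norm `‖v - 1 v̄ᵀ‖²` of the stacked consensus error. -/
def consensusErr {n d : ℕ} (v : Fin n → Vec d) : ℝ := ∑ i, ‖v i - avg v‖ ^ 2

/-- `Φ(x) = (1/n) ∑ᵢ max_{y ∈ Yᵢ} fᵢ(x, y)`. -/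
def primal {n d : ℕ} {p : Fin n → ℕ} (f : ∀ i, Vec d → Vec (p i) → ℝ)
    (Y : ∀ i, Set (Vec (p i))) (x : Vec d) : ℝ :=
  (n : ℝ)⁻¹ * ∑ i, maxValue (f i) (Y i) x

/-- The spectral norm of `W - 1 1ᵀ / n`. -/
def mixingRate {n : ℕ} (W : Matrix (Fin n) (Fin n) ℝ) : ℝ :=
  ‖Matrix.toEuclideanCLM (𝕜 := ℝ) (W - Matrix.of fun _ _ : Fin n => (n : ℝ)⁻¹)‖

/-- `W` is a mixing matrix of the connected undirected graph `G`. -/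
structure IsMixing {n : ℕ} (G : SimpleGraph (Fin n)) (W : Matrix (Fin n) (Fin n) ℝ) : Prop where
  connected : G.Connected
  link : ∀ i j, i ≠ j → (G.Adj i j ↔ 0 < W i j ∧ 0 < W j i)
  noLink : ∀ i j, i ≠ j → ¬ G.Adj i j → W i j = 0 ∧ W j i = 0
  nonneg : ∀ i j, 0 ≤ W i j
  symm : W.transpose = W
  stochastic : ∀ i, ∑ j, W i j = 1

/-- `φ` is differentiable and `L`-smooth on `ℝᵈ × Y`, and `μ`-strongly concave in `y ∈ Y`. -/
structure IsSmoothStronglyConcave {d k : ℕ} (φ : Vec d → Vec k → ℝ) (Y : Set (Vec k))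
    (L μ : ℝ) : Prop where
  differentiable : ∀ x, ∀ y ∈ Y,
    DifferentiableAt ℝ (fun q : Pair d k => φ q.fst q.snd) (WithLp.toLp 2 (x, y))
  smooth : ∀ x x', ∀ y ∈ Y, ∀ y' ∈ Y,
    ‖fullGrad φ x y - fullGrad φ x' y'‖ ≤ L * (‖x - x'‖ + ‖y - y'‖)
  strongConcave : ∀ x, ∀ y ∈ Y, ∀ y' ∈ Y,
    φ x y ≤ φ x y' + inner ℝ (fullGrad φ x y').snd (y - y') - μ / 2 * ‖y - y'‖ ^ 2

/-- `h(x, y, ζ)` is an unbiased estimate of `∇φ(x, y)` with variance at most `σ²`, for every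
`x ∈ ℝᵈ` and `y ∈ Y`, where `ζ` is a random sample. -/
structure IsOracle {d k : ℕ} {S Ω : Type*} [MeasurableSpace Ω] (P : Measure Ω)
    (φ : Vec d → Vec k → ℝ) (Y : Set (Vec k)) (σ : ℝ)
    (h : Vec d → Vec k → S → Pair d k) (ζ : Ω → S) : Prop where
  memLp : ∀ x, ∀ y ∈ Y, MemLp (fun ω => h x y (ζ ω)) 2 P
  unbiased : ∀ x, ∀ y ∈ Y, ∫ ω, h x y (ζ ω) ∂P = fullGrad φ x y
  variance : ∀ x, ∀ y ∈ Y, ∫ ω, ‖h x y (ζ ω) - fullGrad φ x y‖ ^ 2 ∂P ≤ σ ^ 2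

/-- The mini-batch stochastic gradient `(1/b) ∑ⱼ h(x, y, ξⱼ)`. -/
def batchGrad {d k b : ℕ} {S : Type*} (h : Vec d → Vec k → S → Pair d k)
    (x : Vec d) (y : Vec k) (s : Fin b → S) : Pair d k :=
  (b : ℝ)⁻¹ • ∑ j, h x y (s j)

/-- The variables `(xᵢ, yᵢ, gᵢ)` of all agents. -/
structure State (n d : ℕ) (p : Fin n → ℕ) where
  x : Fin n → Vec d
  y : ∀ i, Vec (p i)
  g : Fin n → Vec d

/-- The iterates of distributed stochastic gradient tracking ascent along the sample sequence
`s`, where `s t i j` is the `j`-th sample drawn by agent `i` at iteration `t`. -/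
def iterate {n d b : ℕ} {p : Fin n → ℕ} {S : Fin n → Type*}
    (h : ∀ i, Vec d → Vec (p i) → S i → Pair d (p i)) (Y : ∀ i, Set (Vec (p i)))
    (W : Matrix (Fin n) (Fin n) ℝ) (ηx ηy : ℝ) (x₀ : Fin n → Vec d) (y₀ : ∀ i, Vec (p i))
    (s : ℕ → ∀ i, Fin b → S i) : ℕ → State n d p
  | 0 => ⟨x₀, y₀, fun i => (batchGrad (h i) (x₀ i) (y₀ i) (s 0 i)).fst⟩
  | t + 1 =>
    let z := iterate h Y W ηx ηy x₀ y₀ s t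
    let x' : Fin n → Vec d := fun i => ∑ j, W i j • (z.x j - ηx • z.g j)
    let y' : ∀ i, Vec (p i) := fun i =>
      proj (Y i) (z.y i + ηy • (batchGrad (h i) (z.x i) (z.y i) (s t i)).snd)
    ⟨x', y', fun i => ∑ j, W i j •
      (z.g j + (batchGrad (h j) (x' j) (y' j) (s (t + 1) j)).fst
        - (batchGrad (h j) (z.x j) (z.y j) (s t j)).fst)⟩

/-- The dual error `δ = ∑ᵢ ‖ŷᵢ(x̄) - yᵢ‖²`. -/
def dualErr {n d : ℕ} {p : Fin n → ℕ} (f : ∀ i, Vec d → Vec (p i) → ℝ)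
    (Y : ∀ i, Set (Vec (p i))) (z : State n d p) : ℝ :=
  ∑ i, ‖argmaxOn (f i) (Y i) (avg z.x) - z.y i‖ ^ 2

/-- The Lyapunov function; `κ = L / μ` and `lam` is the spectral norm of `W - 1 1ᵀ / n`. -/
def lyapunov {n d : ℕ} {p : Fin n → ℕ} (f : ∀ i, Vec d → Vec (p i) → ℝ)
    (Y : ∀ i, Set (Vec (p i))) (Φstar L μ κ lam ηx ηy : ℝ) (z : State n d p) : ℝ :=
  primal f Y (avg z.x) - Φstar
    + 300 * κ ^ 2 * L ^ 2 * ηx / (n * (1 - lam ^ 2)) * consensusErr z.x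
    + 8 * ηx * L ^ 2 / (n * ηy * μ) * dualErr f Y z
    + 2400 * ηx ^ 3 * κ ^ 2 * L ^ 2 / (n * (1 - lam ^ 2) ^ 3) * consensusErr z.g

end DSGTA

end

/-! The proof is a weighted sum of four one-step inequalities that hold on every sample path,
followed by an expectation bound for the noise left over. Put $D=1-\lambda^2$.

The maximizer $\hat y_i$ is $\kappa$-Lipschitz, so by a Danskin argument (`hasGradientAt_maxValue`)
$\Phi$ is differentiable with $L(1+\kappa)$-Lipschitz gradient. The descent lemma gives
`primal_step_le`, whose error is the consensus error plus $\delta$ and which keeps a negative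
multiple of the squared mean gradient. Mixing contracts consensus errors by $\lambda^2$
(`consensusErr_x_step_le`, `consensusErr_g_step_le`), and projected ascent on a strongly concave
function contracts $\delta$ and leaves a negative multiple of the squared dual displacement
(`dual_step_le`). With the Lyapunov weights, each positive coupling term is dominated by a
contraction surplus, by the dual displacement, or by the squared mean gradient (`weighted_sum_le`,
`weight_le_half`). The result is `lyapunov_step_le`.

For the noise, the samples are coordinates of a product space, and conditioning becomes resampling
one coordinate (`map_update_infinitePi`). A quantity that ignores a sample is orthogonal to the
error of that sample (`expZero_inner_err`). The delicate point is that $g^t$ already contains the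
noise of time $t$, so its inner product with that noise is not centred. The mean of $g^t$ is the
mean stochastic gradient (`avg_g`), hence its noise is explicit. For the individual $g_i^t$ only a
sign is needed: the noise enters with nonnegative weights, so the correlation is nonnegative in
expectation (`expLE_neg_inner_g_noiseX`), and it appears with a minus sign. -/

noncomputable section
namespace DSGTA

/-! ### Smooth functions along a segment -/

/-- A monotonicity argument replaces integration of `φ'`, so no regularity of the derivative beyond
the stated bound is needed. -/
theorem abs_sub_sub_le_of_abs_deriv_sub_le {φ φ' : ℝ → ℝ} {K : ℝ}
    (hφ : ∀ s ∈ Set.Icc (0 : ℝ) 1, HasDerivAt φ (φ' s) s)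
    (hK : ∀ s ∈ Set.Icc (0 : ℝ) 1, |φ' s - φ' 0| ≤ K * s) :
    |φ 1 - φ 0 - φ' 0| ≤ K / 2 := by
  -- Used with `ε = 1` and `ε = -1`, the two sides of the absolute value.
  have key : ∀ ε : ℝ, (∀ s ∈ Set.Icc (0 : ℝ) 1, ε * (φ' s - φ' 0) ≤ K * s) →
      ε * (φ 1 - φ 0 - φ' 0) ≤ K / 2 := by
    intro ε hε
    have hd : ∀ s ∈ Set.Icc (0 : ℝ) 1,
        HasDerivAt (fun s => ε * (φ s - φ' 0 * s) - K / 2 * s ^ 2)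
          (ε * (φ' s - φ' 0) - K * s) s := by
      intro s hs
      have h1 := (((hφ s hs).sub ((hasDerivAt_id s).const_mul (φ' 0))).const_mul ε).sub
        ((hasDerivAt_pow 2 s).const_mul (K / 2))
      refine h1.congr_deriv ?_
      simp
      ring
    have hanti : AntitoneOn (fun s => ε * (φ s - φ' 0 * s) - K / 2 * s ^ 2)
        (Set.Icc (0 : ℝ) 1) := by
      refine antitoneOn_of_deriv_nonpos (convex_Icc 0 1)
        (fun s hs => (hd s hs).continuousAt.continuousWithinAt) ?_ ?_
      · intro s hs
        rw [interior_Icc] at hs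
        exact (hd s (Set.Ioo_subset_Icc_self hs)).differentiableAt.differentiableWithinAt
      · intro s hs
        rw [interior_Icc] at hs
        rw [(hd s (Set.Ioo_subset_Icc_self hs)).deriv]
        linarith [hε s (Set.Ioo_subset_Icc_self hs)]
    have := hanti (Set.left_mem_Icc.2 zero_le_one) (Set.right_mem_Icc.2 zero_le_one) zero_le_one
    simp only at this
    linarith
  rw [abs_le]
  have h1 := key 1 fun s hs => by linarith [(abs_le.1 (hK s hs)).2]
  have h2 := key (-1) fun s hs => by linarith [(abs_le.1 (hK s hs)).1]
  constructor <;> linarith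

theorem hasDerivAt_add_smul {F : Type*} [NormedAddCommGroup F] [NormedSpace ℝ F] (x v : F)
    (s : ℝ) : HasDerivAt (fun s : ℝ => x + s • v) v s := by
  simpa using ((hasDerivAt_id s).smul_const v).const_add x

theorem abs_sub_sub_inner_le_of_gradient {F : Type*} [NormedAddCommGroup F]
    [InnerProductSpace ℝ F] [CompleteSpace F] {Ψ : F → ℝ} {g : F → F} {K : ℝ}
    (hΨ : ∀ x, HasGradientAt Ψ (g x) x) (hg : ∀ x x', ‖g x - g x'‖ ≤ K * ‖x - x'‖) (x x' : F) :
    |Ψ x' - Ψ x - inner ℝ (g x) (x' - x)| ≤ K / 2 * ‖x' - x‖ ^ 2 := by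
  have h := abs_sub_sub_le_of_abs_deriv_sub_le (φ := fun s : ℝ => Ψ (x + s • (x' - x)))
    (φ' := fun s => inner ℝ (g (x + s • (x' - x))) (x' - x)) (K := K * ‖x' - x‖ ^ 2) ?_ ?_
  · simp only [one_smul, zero_smul, add_zero, add_sub_cancel] at h
    linarith
  · intro s _
    have := (hΨ (x + s • (x' - x))).hasFDerivAt.comp_hasDerivAt s
      (hasDerivAt_add_smul x (x' - x) s)
    exact this.congr_deriv (by simp)
  · intro s hs
    rw [← inner_sub_left]
    refine (abs_real_inner_le_norm _ _).trans ?_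
    have h2 := hg (x + s • (x' - x)) (x + (0 : ℝ) • (x' - x))
    rw [zero_smul, add_zero, add_sub_cancel_left, norm_smul, Real.norm_of_nonneg hs.1] at h2
    rw [zero_smul, add_zero]
    nlinarith [mul_le_mul_of_nonneg_right h2 (norm_nonneg (x' - x))]

/-! ### Projection onto a convex compact set -/

section Projection

variable {k : ℕ} {Y : Set (Vec k)}

theorem proj_spec (hY : IsCompact Y) (hne : Y.Nonempty) (u : Vec k) :
    proj Y u ∈ Y ∧ IsMinOn (fun z => dist u z) Y (proj Y u) :=
  Classical.epsilon_spec (p := fun y => y ∈ Y ∧ IsMinOn (fun z => dist u z) Y y)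
    (hY.exists_isMinOn hne (by fun_prop))

theorem proj_mem (hY : IsCompact Y) (hne : Y.Nonempty) (u : Vec k) : proj Y u ∈ Y :=
  (proj_spec hY hne u).1

theorem inner_sub_proj_le (hc : Convex ℝ Y) (hY : IsCompact Y) (hne : Y.Nonempty) (u : Vec k)
    {z : Vec k} (hz : z ∈ Y) : inner ℝ (u - proj Y u) (z - proj Y u) ≤ 0 := by
  have hs := proj_spec hY hne u
  refine (norm_eq_iInf_iff_real_inner_le_zero hc hs.1).1 ?_ z hz
  have : Nonempty Y := ⟨⟨_, hs.1⟩⟩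
  refine le_antisymm (le_ciInf fun w => ?_) ?_
  · have := hs.2 w.2
    simpa [dist_eq_norm] using this
  · exact ciInf_le (f := fun w : Y => ‖u - w‖) ⟨0, by rintro _ ⟨w, rfl⟩; exact norm_nonneg _⟩
      ⟨_, hs.1⟩

/-- Adding the two variational inequalities gives firm nonexpansiveness. The resulting continuity of
the projection serves the measurability of the iterates. -/
theorem dist_proj_le (hc : Convex ℝ Y) (hY : IsCompact Y) (hne : Y.Nonempty) (u v : Vec k) :
    dist (proj Y u) (proj Y v) ≤ dist u v := by
  have h1 := inner_sub_proj_le hc hY hne u (proj_mem hY hne v)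
  have h2 := inner_sub_proj_le hc hY hne v (proj_mem hY hne u)
  rw [dist_eq_norm, dist_eq_norm]
  set a := proj Y u
  set b := proj Y v
  have h3 : ‖a - b‖ ^ 2 ≤ inner ℝ (u - v) (a - b) := by
    rw [← real_inner_self_eq_norm_sq]
    have e1 : inner ℝ (u - a) (b - a) = -inner ℝ (u - a) (a - b) := by
      rw [← inner_neg_right, neg_sub]
    rw [e1] at h1
    have e2 : inner ℝ (u - v) (a - b)
        = inner ℝ (u - a) (a - b) - inner ℝ (v - b) (a - b) + inner ℝ (a - b) (a - b) := by
      rw [← inner_sub_left, ← inner_add_left]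
      congr 1
      abel
    linarith
  have h4 := real_inner_le_norm (u - v) (a - b)
  by_contra! h5
  nlinarith [norm_nonneg (u - v), norm_nonneg (a - b)]

theorem continuous_proj (hc : Convex ℝ Y) (hY : IsCompact Y) (hne : Y.Nonempty) :
    Continuous (proj Y) :=
  (LipschitzWith.of_dist_le_mul (K := 1)
    fun u v => by simpa using dist_proj_le hc hY hne u v).continuous

end Projection

/-! ### One strongly concave objective -/

section Objective

variable {d k : ℕ} {φ : Vec d → Vec k → ℝ} {Y : Set (Vec k)} {L μ : ℝ}

theorem norm_fst_le_pair (q : Pair d k) : ‖q.fst‖ ≤ ‖q‖ := by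
  refine le_of_sq_le_sq ?_ (norm_nonneg q)
  rw [WithLp.prod_norm_sq_eq_of_L2]
  nlinarith [norm_nonneg q.snd]

theorem norm_snd_le_pair (q : Pair d k) : ‖q.snd‖ ≤ ‖q‖ := by
  refine le_of_sq_le_sq ?_ (norm_nonneg q)
  rw [WithLp.prod_norm_sq_eq_of_L2]
  nlinarith [norm_nonneg q.fst]

theorem continuousAt_comp_of_norm_sub_le {E F : Type*} [NormedAddCommGroup E] [NormedSpace ℝ E]
    [NormedAddCommGroup F] {f : E → ℝ} {g : F → E} {y : F} (hf : DifferentiableAt ℝ f (g y))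
    (hg : ∀ a b, ‖g a - g b‖ ≤ ‖a - b‖) : ContinuousAt (f ∘ g) y :=
  ContinuousAt.comp hf.continuousAt (LipschitzWith.of_dist_le_mul (K := 1)
    fun a b => by simpa [dist_eq_norm] using hg a b).continuous.continuousAt

theorem nonempty_of_diam_pos (hd : 0 < Metric.diam Y) : Y.Nonempty := by
  by_contra h
  rw [Set.not_nonempty_iff_eq_empty] at h
  simp [h] at hd

namespace IsSmoothStronglyConcave

theorem hasDerivAt_line (h : IsSmoothStronglyConcave φ Y L μ) (x u : Vec d) (y v : Vec k) {s : ℝ}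
    (hy : y + s • v ∈ Y) :
    HasDerivAt (fun s : ℝ => φ (x + s • u) (y + s • v))
      (inner ℝ (fullGrad φ (x + s • u) (y + s • v)).fst u
        + inner ℝ (fullGrad φ (x + s • u) (y + s • v)).snd v) s := by
  have h2 := (h.differentiable (x + s • u) _ hy).hasGradientAt.hasFDerivAt
  have h4 : (WithLp.toLp 2 (x + s • u, y + s • v) : Pair d k)
      = WithLp.toLp 2 (x, y) + s • WithLp.toLp 2 (u, v) := rfl
  have h3 : HasDerivAt ((fun q : Pair d k => φ q.fst q.snd) ∘
      fun s : ℝ => (WithLp.toLp 2 (x, y) : Pair d k) + s • WithLp.toLp 2 (u, v)) _ s :=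
    HasFDerivAt.comp_hasDerivAt_of_eq s h2 (hasDerivAt_add_smul _ _ s) h4
  refine HasDerivAt.congr_deriv h3 ?_
  rw [InnerProductSpace.toDual_apply_apply, WithLp.prod_inner_apply]
  rfl

/-- The segment stays in $\mathbb R^d\times Y$ by convexity, the only region where `φ` is known to
be differentiable. Moving one variable at a time avoids the cross term of $(\|u\|+\|v\|)^2$ and
keeps the constant $L/2$. -/
theorem abs_line_le (h : IsSmoothStronglyConcave φ Y L μ) (hc : Convex ℝ Y) (x u : Vec d)
    {y y' : Vec k} (hy : y ∈ Y) (hy' : y' ∈ Y) (huv : u = 0 ∨ y' = y) :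
    |φ (x + u) y' - φ x y - (inner ℝ (fullGrad φ x y).fst u
        + inner ℝ (fullGrad φ x y).snd (y' - y))| ≤ L / 2 * (‖u‖ ^ 2 + ‖y' - y‖ ^ 2) := by
  have hmem : ∀ s ∈ Set.Icc (0 : ℝ) 1, y + s • (y' - y) ∈ Y := fun s hs =>
    hc.add_smul_sub_mem hy hy' hs
  have := abs_sub_sub_le_of_abs_deriv_sub_le (φ := fun s : ℝ => φ (x + s • u) (y + s • (y' - y)))
    (φ' := fun s => inner ℝ (fullGrad φ (x + s • u) (y + s • (y' - y))).fst u
        + inner ℝ (fullGrad φ (x + s • u) (y + s • (y' - y))).snd (y' - y))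
    (K := L * (‖u‖ ^ 2 + ‖y' - y‖ ^ 2))
    (fun s hs => h.hasDerivAt_line x u y (y' - y) (hmem s hs)) ?_
  · simp only [one_smul, zero_smul, add_zero, add_sub_cancel] at this
    linarith
  · intro s hs
    have h1 := h.smooth (x + s • u) x _ (hmem s hs) y hy
    simp only [zero_smul, add_zero]
    set a := fullGrad φ (x + s • u) (y + s • (y' - y))
    set b := fullGrad φ x y
    rw [add_sub_cancel_left, add_sub_cancel_left, norm_smul, norm_smul,
      Real.norm_of_nonneg hs.1] at h1
    have h2 := norm_fst_le_pair (a - b)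
    have h3 := norm_snd_le_pair (a - b)
    rw [WithLp.sub_fst] at h2
    rw [WithLp.sub_snd] at h3
    have e : inner ℝ a.fst u + inner ℝ a.snd (y' - y) - (inner ℝ b.fst u + inner ℝ b.snd (y' - y))
        = inner ℝ (a.fst - b.fst) u + inner ℝ (a.snd - b.snd) (y' - y) := by
      rw [inner_sub_left, inner_sub_left]; ring
    rw [e]
    rcases huv with rfl | rfl
    · simp only [inner_zero_right, zero_add, norm_zero, mul_zero] at h1 ⊢
      refine (abs_real_inner_le_norm _ _).trans ?_
      nlinarith [mul_le_mul_of_nonneg_right (h3.trans h1) (norm_nonneg (y' - y))]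
    · simp only [sub_self, inner_zero_right, add_zero, norm_zero, mul_zero] at h1 ⊢
      refine (abs_real_inner_le_norm _ _).trans ?_
      nlinarith [mul_le_mul_of_nonneg_right (h2.trans h1) (norm_nonneg u)]

theorem mul_norm_sq_le (h : IsSmoothStronglyConcave φ Y L μ) (x : Vec d) {y y' : Vec k}
    (hy : y ∈ Y) (hy' : y' ∈ Y) :
    μ * ‖y - y'‖ ^ 2 ≤ inner ℝ ((fullGrad φ x y').snd - (fullGrad φ x y).snd) (y - y') := by
  have h1 := h.strongConcave x y hy y' hy'
  have h2 := h.strongConcave x y' hy' y hy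
  have e : inner ℝ (fullGrad φ x y).snd (y' - y) = -inner ℝ (fullGrad φ x y).snd (y - y') := by
    rw [← inner_neg_right, neg_sub]
  rw [e, norm_sub_rev y' y] at h2
  rw [inner_sub_left]
  linarith

/-- Positive diameter supplies two distinct points, at which strong monotonicity of the `y`-gradient
is compared with its Lipschitz bound. This is the source of $\kappa\ge1$. -/
theorem le_smoothness (h : IsSmoothStronglyConcave φ Y L μ) (hd : 0 < Metric.diam Y) : μ ≤ L := by
  obtain ⟨y, hy, y', hy', hne⟩ : ∃ y ∈ Y, ∃ y' ∈ Y, y ≠ y' := by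
    by_contra! hcon
    have : Y.Subsingleton := fun a ha b hb => hcon a ha b hb
    rw [Metric.diam_subsingleton this] at hd
    exact lt_irrefl _ hd
  have h1 := h.mul_norm_sq_le 0 hy hy'
  have h2 := h.smooth 0 0 y' hy' y hy
  have h3 := norm_snd_le_pair (fullGrad φ 0 y' - fullGrad φ 0 y)
  rw [WithLp.sub_snd] at h3
  rw [sub_self, norm_zero, zero_add, norm_sub_rev y' y] at h2
  have h4 := (real_inner_le_norm ((fullGrad φ 0 y').snd - (fullGrad φ 0 y).snd) (y - y'))
  have h5 : 0 < ‖y - y'‖ := norm_pos_iff.2 (sub_ne_zero.2 hne)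
  have h6 : μ * ‖y - y'‖ ^ 2 ≤ L * ‖y - y'‖ ^ 2 := by
    nlinarith [mul_le_mul_of_nonneg_right (h3.trans h2) h5.le]
  exact le_of_mul_le_mul_right h6 (by positivity)

theorem continuousOn_right (h : IsSmoothStronglyConcave φ Y L μ) (x : Vec d) :
    ContinuousOn (fun y => φ x y) Y := by
  intro y hy
  refine (continuousAt_comp_of_norm_sub_le (g := fun y : Vec k => (WithLp.toLp 2 (x, y) : Pair d k))
    (h.differentiable x y hy) fun a b => ?_).continuousWithinAt
  refine le_of_sq_le_sq ?_ (norm_nonneg _)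
  rw [WithLp.prod_norm_sq_eq_of_L2]
  simp

theorem argmaxOn_spec (h : IsSmoothStronglyConcave φ Y L μ) (hY : IsCompact Y) (hne : Y.Nonempty)
    (x : Vec d) : argmaxOn φ Y x ∈ Y ∧ IsMaxOn (fun z => φ x z) Y (argmaxOn φ Y x) :=
  Classical.epsilon_spec (p := fun y => y ∈ Y ∧ IsMaxOn (fun z => φ x z) Y y)
    (hY.exists_isMaxOn hne (h.continuousOn_right x))

theorem maxValue_eq (h : IsSmoothStronglyConcave φ Y L μ) (hY : IsCompact Y) (hne : Y.Nonempty)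
    (x : Vec d) : maxValue φ Y x = φ x (argmaxOn φ Y x) := by
  have hs := h.argmaxOn_spec hY hne x
  refine IsLUB.csSup_eq (IsGreatest.isLUB ⟨⟨_, hs.1, rfl⟩, ?_⟩) (hne.image _)
  rintro _ ⟨y, hy, rfl⟩
  exact hs.2 hy

theorem inner_grad_argmaxOn_le (h : IsSmoothStronglyConcave φ Y L μ) (hc : Convex ℝ Y)
    (hY : IsCompact Y) (x : Vec d) {y : Vec k} (hy : y ∈ Y) :
    inner ℝ (fullGrad φ x (argmaxOn φ Y x)).snd (y - argmaxOn φ Y x) ≤ 0 := by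
  obtain ⟨hm, hmax⟩ := h.argmaxOn_spec hY ⟨y, hy⟩ x
  set a := argmaxOn φ Y x
  have h1 := h.hasDerivAt_line x 0 a (y - a) (s := 0) (by simpa using hm)
  simp only [smul_zero, add_zero, inner_zero_right, zero_add, zero_smul] at h1
  -- The maximizer may lie on the boundary of `Y`, so the variation is one-sided: direction `1` at
  -- the left end of `[0, 1]`.
  have h2 := IsLocalMaxOn.hasFDerivWithinAt_nonpos (s := Set.Icc (0 : ℝ) 1)
    (f := fun s : ℝ => φ x (a + s • (y - a))) (a := 0) (y := 1) ?_
    h1.hasFDerivAt.hasFDerivWithinAt ?_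
  · simpa using h2
  · refine IsMaxOn.localize ?_
    intro s hs
    have := hmax (hc.add_smul_sub_mem hm hy hs)
    simpa using this
  · have := sub_mem_posTangentConeAt_of_segment_subset (s := Set.Icc (0 : ℝ) 1) (x := 0) (y := 1)
      (by rw [segment_eq_Icc zero_le_one])
    simpa using this

theorem le_sub_argmaxOn (h : IsSmoothStronglyConcave φ Y L μ) (hc : Convex ℝ Y)
    (hY : IsCompact Y) (x : Vec d) {y : Vec k} (hy : y ∈ Y) :
    φ x y ≤ φ x (argmaxOn φ Y x) - μ / 2 * ‖y - argmaxOn φ Y x‖ ^ 2 := by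
  have h1 := h.strongConcave x y hy _ (h.argmaxOn_spec hY ⟨y, hy⟩ x).1
  linarith [h.inner_grad_argmaxOn_le hc hY x hy]

/-- With $a,a'$ the two maximizers, strong monotonicity at $x$ and both optimality conditions give
$\mu\|a-a'\|^2\le\langle\nabla_y\varphi(x,a')-\nabla_y\varphi(x',a'),a-a'\rangle$, and the right
side is at most $L\|x-x'\|\|a-a'\|$. -/
theorem norm_argmaxOn_sub_le (h : IsSmoothStronglyConcave φ Y L μ) (hμ : 0 < μ) (hL : 0 ≤ L)
    (hc : Convex ℝ Y) (hY : IsCompact Y) (hne : Y.Nonempty) (x x' : Vec d) :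
    ‖argmaxOn φ Y x - argmaxOn φ Y x'‖ ≤ L / μ * ‖x - x'‖ := by
  have hm := (h.argmaxOn_spec hY hne x).1
  have hm' := (h.argmaxOn_spec hY hne x').1
  have h1 := h.inner_grad_argmaxOn_le hc hY x hm'
  have h2 := h.inner_grad_argmaxOn_le hc hY x' hm
  set a := argmaxOn φ Y x
  set a' := argmaxOn φ Y x'
  have h3 := h.mul_norm_sq_le x hm hm'
  have h4 := h.smooth x x' a' hm' a' hm'
  have h5 := norm_snd_le_pair (fullGrad φ x a' - fullGrad φ x' a')
  rw [WithLp.sub_snd] at h5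
  rw [sub_self, norm_zero, add_zero] at h4
  have e : inner ℝ (fullGrad φ x a).snd (a' - a) = -inner ℝ (fullGrad φ x a).snd (a - a') := by
    rw [← inner_neg_right, neg_sub]
  have h6 := real_inner_le_norm ((fullGrad φ x a').snd - (fullGrad φ x' a').snd) (a - a')
  rw [inner_sub_left] at h3 h6
  rw [e] at h1
  have h7 : μ * ‖a - a'‖ ^ 2 ≤ L * ‖x - x'‖ * ‖a - a'‖ := by
    nlinarith [mul_le_mul_of_nonneg_right (h5.trans h4) (norm_nonneg (a - a'))]
  rw [div_mul_eq_mul_div, le_div_iff₀ hμ]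
  by_contra! h8
  have : 0 < ‖a - a'‖ := by
    by_contra! h9
    have : ‖a - a'‖ = 0 := le_antisymm h9 (norm_nonneg _)
    rw [this] at h8
    nlinarith [norm_nonneg (x - x')]
  nlinarith

theorem norm_fst_grad_argmaxOn_sub_le (h : IsSmoothStronglyConcave φ Y L μ) (hμ : 0 < μ)
    (hL : 0 ≤ L) (hc : Convex ℝ Y) (hY : IsCompact Y) (hne : Y.Nonempty) (x x' : Vec d) :
    ‖(fullGrad φ x (argmaxOn φ Y x)).fst - (fullGrad φ x' (argmaxOn φ Y x')).fst‖
      ≤ L * (1 + L / μ) * ‖x - x'‖ := by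
  have h1 := h.smooth x x' _ (h.argmaxOn_spec hY hne x).1 _ (h.argmaxOn_spec hY hne x').1
  have h2 := norm_fst_le_pair (fullGrad φ x (argmaxOn φ Y x) - fullGrad φ x' (argmaxOn φ Y x'))
  rw [WithLp.sub_fst] at h2
  nlinarith [mul_le_mul_of_nonneg_left (h.norm_argmaxOn_sub_le hμ hL hc hY hne x x') hL]

/-- Danskin's theorem by a sandwich: keeping the old maximizer bounds the increment from below,
keeping the new one bounds it from above. The two linearizations differ by a gradient change of
order $\|a-a'\|$, hence of order $\|x-x'\|$, so the error is quadratic. -/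
theorem hasGradientAt_maxValue (h : IsSmoothStronglyConcave φ Y L μ) (hμ : 0 < μ) (hL : 0 ≤ L)
    (hc : Convex ℝ Y) (hY : IsCompact Y) (hne : Y.Nonempty) (x : Vec d) :
    HasGradientAt (maxValue φ Y) (fullGrad φ x (argmaxOn φ Y x)).fst x := by
  rw [hasGradientAt_iff_hasFDerivAt, hasFDerivAt_iff_isLittleO]
  have hbound : ∀ x', ‖maxValue φ Y x' - maxValue φ Y x
      - inner ℝ (fullGrad φ x (argmaxOn φ Y x)).fst (x' - x)‖
      ≤ (L / 2 + L * (1 + L / μ)) * ‖‖x' - x‖ ^ 2‖ := by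
    intro x'
    obtain ⟨hm, hmax⟩ := h.argmaxOn_spec hY hne x
    obtain ⟨hm', hmax'⟩ := h.argmaxOn_spec hY hne x'
    have hG := h.norm_fst_grad_argmaxOn_sub_le hμ hL hc hY hne x x'
    have hlip := h.norm_argmaxOn_sub_le hμ hL hc hY hne x x'
    rw [h.maxValue_eq hY hne, h.maxValue_eq hY hne, Real.norm_eq_abs, Real.norm_of_nonneg
      (sq_nonneg _)]
    set a := argmaxOn φ Y x
    set a' := argmaxOn φ Y x'
    have h1 := h.abs_line_le hc x (x' - x) hm hm (Or.inr rfl)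
    have h2 := h.abs_line_le hc x (x' - x) hm' hm' (Or.inr rfl)
    simp only [add_sub_cancel, sub_self, inner_zero_right, add_zero, norm_zero] at h1 h2
    have h3 : φ x' a ≤ φ x' a' := hmax' hm
    have h4 : φ x a' ≤ φ x a := hmax hm'
    have h5 := h.smooth x x a' hm' a hm
    have h6 := norm_fst_le_pair (fullGrad φ x a' - fullGrad φ x a)
    rw [WithLp.sub_fst] at h6
    rw [sub_self, norm_zero, zero_add, norm_sub_rev] at h5
    have h7 := real_inner_le_norm ((fullGrad φ x a').fst - (fullGrad φ x a).fst) (x' - x)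
    rw [inner_sub_left] at h7
    have h8 : ‖(fullGrad φ x a').fst - (fullGrad φ x a).fst‖ ≤ L * (1 + L / μ) * ‖x' - x‖ := by
      rw [norm_sub_rev x' x]
      have := mul_le_mul_of_nonneg_left hlip hL
      rw [norm_sub_rev] at this
      rw [norm_sub_rev (fullGrad φ x a)] at h5
      nlinarith [norm_nonneg (x - x'), norm_sub_rev a a', norm_sub_rev (fullGrad φ x a')
        (fullGrad φ x a), norm_nonneg (a - a')]
    have h9 := mul_le_mul_of_nonneg_right h8 (norm_nonneg (x' - x))
    have h10 : 0 ≤ L * (1 + L / μ) * ‖x' - x‖ ^ 2 := by positivity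
    rw [abs_le] at h1 h2 ⊢
    constructor <;> nlinarith
  refine (Asymptotics.IsBigO.of_bound (g := fun x' => ‖x' - x‖ ^ 2)
    (L / 2 + L * (1 + L / μ))
    (Filter.Eventually.of_forall fun x' => ?_)).trans_isLittleO ?_
  · rw [InnerProductSpace.toDual_apply_apply]
    exact hbound x'
  · exact Asymptotics.isLittleO_pow_sub_sub x one_lt_two

/-- One projected ascent step, with the gradient taken at a perturbed primal point and perturbed
by the noise `ν`. -/
theorem norm_sq_ascent_step_le (h : IsSmoothStronglyConcave φ Y L μ) (hμ : 0 < μ)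
    (hc : Convex ℝ Y) (hY : IsCompact Y) {η : ℝ} (hη : 0 < η) (hηL : η * L ≤ 1 / 9)
    (x x' : Vec d) {y : Vec k} (hy : y ∈ Y) (ν : Vec k) :
    (1 + η * μ / 2) * ‖proj Y (y + η • ((fullGrad φ x' y).snd + ν)) - argmaxOn φ Y x‖ ^ 2 ≤
      (1 - η * μ) * ‖argmaxOn φ Y x - y‖ ^ 2 + 2 * η * (L / μ) * L * ‖x' - x‖ ^ 2
      + 2 * η * inner ℝ (y - argmaxOn φ Y x) ν + 2 * η ^ 2 * ‖ν‖ ^ 2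
      - 3 / 8 * ‖proj Y (y + η • ((fullGrad φ x' y).snd + ν)) - y‖ ^ 2 := by
  have hm := (h.argmaxOn_spec hY ⟨y, hy⟩ x).1
  have h1 := inner_sub_proj_le hc hY ⟨y, hy⟩ (y + η • ((fullGrad φ x' y).snd + ν)) hm
  have hp := proj_mem hY ⟨y, hy⟩ (y + η • ((fullGrad φ x' y).snd + ν))
  set z := proj Y (y + η • ((fullGrad φ x' y).snd + ν))
  set a := argmaxOn φ Y x with ha
  have h2 := h.abs_line_le hc x 0 hy hp (Or.inl rfl)
  simp only [add_zero, inner_zero_right, zero_add, norm_zero] at h2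
  have h3 := h.strongConcave x a hm y hy
  have h4 := h.le_sub_argmaxOn hc hY x hp
  rw [← ha] at h4
  have h5 := h.smooth x' x y hy y hy
  have h6 := norm_snd_le_pair (fullGrad φ x' y - fullGrad φ x y)
  rw [WithLp.sub_snd] at h6
  rw [sub_self, norm_zero, add_zero] at h5
  set e := (fullGrad φ x' y).snd - (fullGrad φ x y).snd with he
  set v := (fullGrad φ x y).snd
  have hv : (fullGrad φ x' y).snd = v + e := by rw [he]; abel
  rw [hv] at h1
  have h7 : ‖e‖ ≤ L * ‖x' - x‖ := h6.trans h5
  -- three-point identity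
  have e1 : inner ℝ (y + η • (v + e + ν) - z) (a - z)
      = (‖z - y‖ ^ 2 + ‖z - a‖ ^ 2 - ‖a - y‖ ^ 2) / 2
        + η * (inner ℝ v (a - y) - inner ℝ v (z - y)) - η * inner ℝ e (z - a)
        + η * inner ℝ (y - a) ν * (-1) - η * inner ℝ ν (z - y) := by
    have t1 : ‖a - y‖ ^ 2 = ‖z - y‖ ^ 2 - 2 * inner ℝ (z - y) (z - a) + ‖z - a‖ ^ 2 := by
      rw [← norm_sub_sq_real]; congr 2; abel
    rw [t1]
    rw [real_inner_comm ν (y - a)]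
    simp only [inner_add_left, inner_sub_left, inner_sub_right, inner_smul_left, conj_trivial,
      real_inner_comm]
    simp only [real_inner_comm a y, real_inner_comm z y]
    ring
  rw [e1] at h1
  -- The weight `μ / 4` spends half of the gain $\eta\mu\|z-a\|^2$ from strong concavity. The other
  -- half is the factor $1+\eta\mu/2$ of the conclusion, which later pays for the drift of the
  -- maximizer.
  have h8 : inner ℝ e (z - a) ≤ μ / 4 * ‖z - a‖ ^ 2 + L ^ 2 / μ * ‖x' - x‖ ^ 2 := by
    have t1 := real_inner_le_norm e (z - a)
    have t2 : ‖e‖ * ‖z - a‖ ≤ μ / 4 * ‖z - a‖ ^ 2 + ‖e‖ ^ 2 / μ := by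
      have : μ / 4 * ‖z - a‖ ^ 2 + ‖e‖ ^ 2 / μ - ‖e‖ * ‖z - a‖
          = (μ * ‖z - a‖ - 2 * ‖e‖) ^ 2 / (4 * μ) := by
        field_simp; ring
      have : 0 ≤ (μ * ‖z - a‖ - 2 * ‖e‖) ^ 2 / (4 * μ) := by positivity
      linarith
    have t3 : ‖e‖ ^ 2 / μ ≤ L ^ 2 / μ * ‖x' - x‖ ^ 2 := by
      rw [div_mul_eq_mul_div]
      refine div_le_div_of_nonneg_right ?_ hμ.le
      rw [← mul_pow]
      exact pow_le_pow_left₀ (norm_nonneg _) h7 2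
    linarith
  -- The point `z` depends on `ν`, so this product is not centred and is estimated. Only the product
  -- of `ν` with `y - a` is kept exactly.
  have h9 : 2 * η * inner ℝ ν (z - y) ≤ 2 * η ^ 2 * ‖ν‖ ^ 2 + 1 / 2 * ‖z - y‖ ^ 2 := by
    have t1 := real_inner_le_norm ν (z - y)
    nlinarith [mul_le_mul_of_nonneg_left t1 hη.le, sq_nonneg (2 * η * ‖ν‖ - ‖z - y‖)]
  have h10 := (abs_le.1 h2).1
  have e2 : 2 * η * (L / μ) * L * ‖x' - x‖ ^ 2 = 2 * η * (L ^ 2 / μ * ‖x' - x‖ ^ 2) := by ring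
  rw [e2]
  have h11 := mul_le_mul_of_nonneg_left h8 hη.le
  have h12 : η * (inner ℝ v (z - y) - inner ℝ v (a - y)) ≤
      η * (L / 2 * ‖z - y‖ ^ 2 - μ / 2 * ‖z - a‖ ^ 2 - μ / 2 * ‖a - y‖ ^ 2) :=
    mul_le_mul_of_nonneg_left (by linarith) hη.le
  -- The surviving coefficient of $\|z-y\|^2$ is $1-\tfrac19-\tfrac12=\tfrac7{18}\ge\tfrac38$.
  have h13 : η * L * ‖z - y‖ ^ 2 ≤ 1 / 9 * ‖z - y‖ ^ 2 :=
    mul_le_mul_of_nonneg_right hηL (sq_nonneg _)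
  have h14 := sq_nonneg ‖z - y‖
  nlinarith

end IsSmoothStronglyConcave

end Objective

/-! ### Averages and consensus errors -/

section Consensus

variable {n d : ℕ}

/-- One round of averaging with the neighbours, `v ↦ W v`. -/
def mix (W : Matrix (Fin n) (Fin n) ℝ) (v : Fin n → Vec d) (i : Fin n) : Vec d :=
  ∑ j, W i j • v j

theorem avg_add (u v : Fin n → Vec d) : avg (u + v) = avg u + avg v := by
  simp [avg, Finset.sum_add_distrib, smul_add]

theorem avg_sub (u v : Fin n → Vec d) : avg (u - v) = avg u - avg v := by
  simp [avg, Finset.sum_sub_distrib, smul_sub]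

theorem avg_smul (c : ℝ) (v : Fin n → Vec d) : avg (c • v) = c • avg v := by
  simp [avg, ← Finset.smul_sum, smul_comm c]

theorem mix_add (W : Matrix (Fin n) (Fin n) ℝ) (u v : Fin n → Vec d) :
    mix W (u + v) = mix W u + mix W v := by
  ext1 i
  simp [mix, Finset.sum_add_distrib, smul_add]

theorem mix_sub (W : Matrix (Fin n) (Fin n) ℝ) (u v : Fin n → Vec d) :
    mix W (u - v) = mix W u - mix W v := by
  ext1 i
  simp [mix, Finset.sum_sub_distrib, smul_sub]

theorem sum_eq_smul_avg (hn : 0 < n) (v : Fin n → Vec d) : ∑ i, v i = (n : ℝ) • avg v := by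
  have : (n : ℝ) ≠ 0 := by positivity
  rw [avg, smul_smul, mul_inv_cancel₀ this, one_smul]

theorem sum_sub_avg (hn : 0 < n) (v : Fin n → Vec d) : ∑ i, (v i - avg v) = 0 := by
  rw [Finset.sum_sub_distrib, sum_eq_smul_avg hn]
  simp [Nat.cast_smul_eq_nsmul]

theorem sum_inner_sub_avg (hn : 0 < n) (u v : Fin n → Vec d) :
    ∑ i, inner ℝ (u i - avg u) (v i - avg v)
      = ∑ i, inner ℝ (u i) (v i) - n * inner ℝ (avg u) (avg v) := by
  have h1 : ∑ i, inner ℝ (u i - avg u) (v i - avg v) = ∑ i, inner ℝ (u i) (v i - avg v) := by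
    simp_rw [inner_sub_left]
    rw [Finset.sum_sub_distrib, ← inner_sum (𝕜 := ℝ) Finset.univ (fun i => v i - avg v) (avg u),
      sum_sub_avg hn, inner_zero_right, sub_zero]
  rw [h1]
  simp_rw [inner_sub_right]
  rw [Finset.sum_sub_distrib, ← sum_inner, sum_eq_smul_avg hn, inner_smul_left]
  simp

theorem sum_inner_sub_avg_right (hn : 0 < n) (u v : Fin n → Vec d) :
    ∑ i, inner ℝ (u i - avg u) (v i - avg v) = ∑ i, inner ℝ (u i - avg u) (v i) := by
  simp_rw [inner_sub_right]
  rw [Finset.sum_sub_distrib, ← sum_inner, sum_sub_avg hn, inner_zero_left, sub_zero]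

theorem consensusErr_eq (hn : 0 < n) (v : Fin n → Vec d) :
    consensusErr v = ∑ i, ‖v i‖ ^ 2 - n * ‖avg v‖ ^ 2 := by
  have := sum_inner_sub_avg hn v v
  simp only [real_inner_self_eq_norm_sq] at this
  exact this

theorem consensusErr_nonneg (v : Fin n → Vec d) : 0 ≤ consensusErr v :=
  Finset.sum_nonneg fun _ _ => sq_nonneg _

theorem consensusErr_le_sum (hn : 0 < n) (v : Fin n → Vec d) :
    consensusErr v ≤ ∑ i, ‖v i‖ ^ 2 := by
  rw [consensusErr_eq hn]
  have : 0 ≤ n * ‖avg v‖ ^ 2 := by positivity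
  linarith

theorem norm_sq_avg_le (hn : 0 < n) (v : Fin n → Vec d) :
    ‖avg v‖ ^ 2 ≤ (n : ℝ)⁻¹ * ∑ i, ‖v i‖ ^ 2 := by
  have h1 := consensusErr_nonneg v
  rw [consensusErr_eq hn] at h1
  have hn' : (0 : ℝ) < n := by exact_mod_cast hn
  rw [inv_mul_eq_div, le_div_iff₀ hn']
  linarith

theorem consensusErr_add (hn : 0 < n) (u v : Fin n → Vec d) :
    consensusErr (u + v)
      = consensusErr u + 2 * ∑ i, inner ℝ (u i - avg u) (v i) + consensusErr v := by
  rw [← sum_inner_sub_avg_right hn]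
  simp only [consensusErr]
  rw [Finset.mul_sum, ← Finset.sum_add_distrib, ← Finset.sum_add_distrib]
  refine Finset.sum_congr rfl fun i _ => ?_
  rw [avg_add, Pi.add_apply, ← norm_add_sq_real]
  congr 2
  abel

theorem norm_add_sq_le_young {F : Type*} [SeminormedAddCommGroup F] {c : ℝ} (hc : 0 < c) (u v : F) :
    ‖u + v‖ ^ 2 ≤ (1 + c) * ‖u‖ ^ 2 + (1 + 1 / c) * ‖v‖ ^ 2 := by
  have h1 : ‖u + v‖ ^ 2 ≤ (‖u‖ + ‖v‖) ^ 2 :=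
    pow_le_pow_left₀ (norm_nonneg _) (norm_add_le u v) 2
  have h2 : (1 + c) * ‖u‖ ^ 2 + (1 + 1 / c) * ‖v‖ ^ 2 - (‖u‖ + ‖v‖) ^ 2
      = (c * ‖u‖ - ‖v‖) ^ 2 / c := by
    field_simp
    ring
  have h3 : 0 ≤ (c * ‖u‖ - ‖v‖) ^ 2 / c := by positivity
  linarith

theorem consensusErr_add_le {c : ℝ} (hc : 0 < c) (u v : Fin n → Vec d) :
    consensusErr (u + v) ≤ (1 + c) * consensusErr u + (1 + 1 / c) * consensusErr v := by
  simp only [consensusErr]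
  rw [Finset.mul_sum, Finset.mul_sum, ← Finset.sum_add_distrib]
  refine Finset.sum_le_sum fun i _ => ?_
  refine le_trans (le_of_eq ?_) (norm_add_sq_le_young hc _ _)
  rw [avg_add, Pi.add_apply]
  congr 2
  abel

theorem consensusErr_smul (c : ℝ) (v : Fin n → Vec d) :
    consensusErr (c • v) = c ^ 2 * consensusErr v := by
  simp only [consensusErr, avg_smul, Pi.smul_apply, ← smul_sub, norm_smul, mul_pow, Finset.mul_sum,
    Real.norm_eq_abs, sq_abs]

/-! ### Mixing -/

/-- The matrix acts on each of the `d` coordinates separately, as an operator on $\mathbb R^n$. -/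
theorem sum_norm_sq_sum_smul_le (M : Matrix (Fin n) (Fin n) ℝ) (v : Fin n → Vec d) :
    ∑ i, ‖∑ j, M i j • v j‖ ^ 2 ≤ ‖Matrix.toEuclideanCLM (𝕜 := ℝ) M‖ ^ 2 * ∑ i, ‖v i‖ ^ 2 := by
  simp only [EuclideanSpace.norm_sq_eq]
  rw [Finset.sum_comm, Finset.sum_comm (f := fun i c => ‖(v i).ofLp c‖ ^ 2), Finset.mul_sum]
  refine Finset.sum_le_sum fun c _ => ?_
  have h1 := (Matrix.toEuclideanCLM (𝕜 := ℝ) M).le_opNorm (WithLp.toLp 2 fun j => v j c)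
  have h2 := pow_le_pow_left₀ (norm_nonneg _) h1 2
  rw [mul_pow, EuclideanSpace.norm_sq_eq, EuclideanSpace.norm_sq_eq] at h2
  refine le_trans (le_of_eq ?_) h2
  refine Finset.sum_congr rfl fun i _ => ?_
  congr 2
  simp [Matrix.toEuclideanCLM_toLp, Matrix.mulVec, dotProduct]

variable {W : Matrix (Fin n) (Fin n) ℝ} {G : SimpleGraph (Fin n)}

theorem IsMixing.pos (hW : IsMixing G W) : 0 < n := by
  have := hW.connected.nonempty
  exact Fin.pos_iff_nonempty.2 this

theorem IsMixing.apply_comm (hW : IsMixing G W) (i j : Fin n) : W i j = W j i := by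
  conv_lhs => rw [← hW.symm, Matrix.transpose_apply]

theorem IsMixing.sum_col (hW : IsMixing G W) (j : Fin n) : ∑ i, W i j = 1 := by
  rw [← hW.stochastic j]
  exact Finset.sum_congr rfl fun i _ => hW.apply_comm i j

theorem IsMixing.sum_mix (hW : IsMixing G W) (v : Fin n → Vec d) :
    ∑ i, mix W v i = ∑ i, v i := by
  simp only [mix]
  rw [Finset.sum_comm]
  refine Finset.sum_congr rfl fun j _ => ?_
  rw [← Finset.sum_smul, hW.sum_col, one_smul]

theorem IsMixing.avg_mix (hW : IsMixing G W) (v : Fin n → Vec d) : avg (mix W v) = avg v := by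
  rw [avg, hW.sum_mix, avg]

theorem IsMixing.sum_inner_mix (hW : IsMixing G W) (u v : Fin n → Vec d) :
    ∑ i, inner ℝ (u i) (mix W v i) = ∑ i, inner ℝ (mix W u i) (v i) := by
  simp only [mix, inner_sum, sum_inner, inner_smul_left, inner_smul_right, conj_trivial]
  rw [Finset.sum_comm]
  refine Finset.sum_congr rfl fun i _ => Finset.sum_congr rfl fun j _ => ?_
  rw [hW.apply_comm]

/-- Because $W\mathbf 1=\mathbf 1$ and mixing preserves the mean, $Wv-\mathbf 1\bar v^T=(W-\mathbf
1\mathbf 1^T/n)(v-\mathbf 1\bar v^T)$. -/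
theorem IsMixing.consensusErr_mix_le (hW : IsMixing G W) (v : Fin n → Vec d) :
    consensusErr (mix W v) ≤ mixingRate W ^ 2 * consensusErr v := by
  refine le_trans (le_of_eq ?_) (sum_norm_sq_sum_smul_le _ fun i => v i - avg v)
  simp only [consensusErr]
  refine Finset.sum_congr rfl fun i _ => ?_
  congr 2
  rw [hW.avg_mix]
  simp only [Matrix.sub_apply, Matrix.of_apply, sub_smul, Finset.sum_sub_distrib, mix, smul_sub]
  rw [← Finset.sum_smul, hW.stochastic, one_smul, ← Finset.smul_sum, ← avg, ← Finset.smul_sum]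
  rw [Finset.sum_const, Finset.card_univ, Fintype.card_fin, ← Nat.cast_smul_eq_nsmul ℝ, smul_smul,
    inv_mul_cancel₀ (by have := hW.pos; positivity), one_smul]
  abel

/-- Jensen's inequality in each row, then summation over columns of total weight one. -/
theorem IsMixing.sum_norm_sq_mix_le (hW : IsMixing G W) (v : Fin n → Vec d) :
    ∑ i, ‖mix W v i‖ ^ 2 ≤ ∑ i, ‖v i‖ ^ 2 := by
  have h1 : ∀ i, ‖mix W v i‖ ^ 2 ≤ ∑ j, W i j * ‖v j‖ ^ 2 := by
    intro i
    have h2 : ‖mix W v i‖ ≤ ∑ j, W i j * ‖v j‖ := by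
      refine (norm_sum_le _ _).trans (le_of_eq (Finset.sum_congr rfl fun j _ => ?_))
      rw [norm_smul, Real.norm_of_nonneg (hW.nonneg i j)]
    refine (pow_le_pow_left₀ (norm_nonneg _) h2 2).trans ?_
    exact Real.pow_arith_mean_le_arith_mean_pow Finset.univ (W i) (fun j => ‖v j‖)
      (fun j _ => hW.nonneg i j) (hW.stochastic i) (fun j _ => norm_nonneg _) 2
  refine (Finset.sum_le_sum fun i _ => h1 i).trans (le_of_eq ?_)
  rw [Finset.sum_comm]
  refine Finset.sum_congr rfl fun j _ => ?_
  rw [← Finset.sum_mul, hW.sum_col, one_mul]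

/-- Young's inequality with parameter $D/2$ after the contraction: $(1-D)(1+D/2)\le1-D/2$ and
$(1-D)(1+2/D)\le2/D$. -/
theorem IsMixing.consensusErr_x_step_le (hW : IsMixing G W) {D : ℝ}
    (hD : D = 1 - mixingRate W ^ 2) (hD0 : 0 < D) (A : ℝ) (x g : Fin n → Vec d) :
    consensusErr (mix W fun j => x j - A • g j) ≤
      (1 - D / 2) * consensusErr x + 2 / D * A ^ 2 * consensusErr g := by
  have h1 := hW.consensusErr_mix_le fun j => x j - A • g j
  have h2 := consensusErr_add_le (half_pos hD0) x ((-A) • g)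
  have e : (fun j => x j - A • g j) = x + (-A) • g := by
    ext1 j
    simp [sub_eq_add_neg]
  rw [e] at h1 ⊢
  rw [consensusErr_smul] at h2
  have hl : mixingRate W ^ 2 = 1 - D := by linarith
  have hD1 : D ≤ 1 := by nlinarith [sq_nonneg (mixingRate W)]
  rw [hl] at h1
  refine h1.trans ((mul_le_mul_of_nonneg_left h2 (by linarith)).trans ?_)
  have e2 : (1 - D) * (1 + 1 / (D / 2)) = 2 / D - 1 - D := by
    field_simp
    ring
  have hx := consensusErr_nonneg x
  have hg := mul_nonneg (sq_nonneg A) (consensusErr_nonneg g)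
  have e3 : (1 - D) * ((1 + D / 2) * consensusErr x
      + (1 + 1 / (D / 2)) * ((-A) ^ 2 * consensusErr g))
      = (1 - D / 2 - D ^ 2 / 2) * consensusErr x
        + (2 / D - 1 - D) * (A ^ 2 * consensusErr g) := by
    rw [← e2]
    ring
  rw [e3]
  nlinarith [mul_nonneg (sq_nonneg D) hx, mul_nonneg hD0.le hg]

/-- One step of gradient tracking, where the local gradients change by `Δ` and the noise changes
from `ν` to `ν'`. -/
theorem IsMixing.consensusErr_g_step_le (hW : IsMixing G W) {D : ℝ}
    (hD : D = 1 - mixingRate W ^ 2) (hD0 : 0 < D) (g ν Δ ν' : Fin n → Vec d) :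
    consensusErr (mix W (g - ν + Δ + ν')) ≤
      (1 - D / 2) * consensusErr g
      + (1 + D / 2) * (∑ i, ‖ν i‖ ^ 2 - n * ‖avg ν‖ ^ 2
          + 2 * (n * inner ℝ (avg g) (avg ν) - ∑ i, inner ℝ (mix W (mix W g) i) (ν i)))
      + 2 / D * ∑ i, ‖Δ i‖ ^ 2
      + 2 * ∑ i, inner ℝ (mix W (fun j => mix W (g - ν + Δ) j - avg (g - ν + Δ)) i) (ν' i)
      + (1 - D) * ∑ i, ‖ν' i‖ ^ 2 := by
  have hn := hW.pos
  have hl : mixingRate W ^ 2 = 1 - D := by linarith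
  have hD1 : D ≤ 1 := by nlinarith [sq_nonneg (mixingRate W)]
  -- The fresh noise is split off by an exact expansion: its cross term will have mean zero, so no
  -- Young factor is paid.
  have h1 : consensusErr (mix W (g - ν + Δ + ν')) = consensusErr (mix W (g - ν + Δ))
      + 2 * ∑ i, inner ℝ (mix W (fun j => mix W (g - ν + Δ) j - avg (g - ν + Δ)) i) (ν' i)
      + consensusErr (mix W ν') := by
    rw [mix_add W _ ν', consensusErr_add hn, hW.sum_inner_mix, hW.avg_mix]
  have h2 : consensusErr (mix W ν') ≤ (1 - D) * ∑ i, ‖ν' i‖ ^ 2 := by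
    rw [← hl]
    exact (hW.consensusErr_mix_le ν').trans
      (mul_le_mul_of_nonneg_left (consensusErr_le_sum hn ν') (sq_nonneg _))
  have h3 : consensusErr (mix W (g - ν + Δ)) ≤ (1 + D / 2) * consensusErr (mix W (g - ν))
      + (1 + 1 / (D / 2)) * consensusErr (mix W Δ) := by
    rw [mix_add]
    exact consensusErr_add_le (half_pos hD0) _ _
  have h4 : (1 + 1 / (D / 2)) * consensusErr (mix W Δ) ≤ 2 / D * ∑ i, ‖Δ i‖ ^ 2 := by
    have h5 : consensusErr (mix W Δ) ≤ (1 - D) * ∑ i, ‖Δ i‖ ^ 2 := by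
      rw [← hl]
      exact (hW.consensusErr_mix_le Δ).trans
        (mul_le_mul_of_nonneg_left (consensusErr_le_sum hn Δ) (sq_nonneg _))
    refine (mul_le_mul_of_nonneg_left h5 (by positivity)).trans ?_
    rw [← mul_assoc]
    refine mul_le_mul_of_nonneg_right ?_ (Finset.sum_nonneg fun _ _ => sq_nonneg _)
    have e2 : (1 + 1 / (D / 2)) * (1 - D) = 2 / D - 1 - D := by
      field_simp
      ring
    linarith
  -- Again an exact expansion. Symmetry of `W` moves both mixings onto `g`, in the form whose
  -- expectation has a sign.
  have h5 : consensusErr (mix W (g - ν)) ≤ (1 - D) * consensusErr g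
      + (∑ i, ‖ν i‖ ^ 2 - n * ‖avg ν‖ ^ 2
          + 2 * (n * inner ℝ (avg g) (avg ν) - ∑ i, inner ℝ (mix W (mix W g) i) (ν i))) := by
    have e1 : g - ν = g + (-1 : ℝ) • ν := by
      rw [neg_one_smul, sub_eq_add_neg]
    have e2 : mix W (g - ν) = mix W g + (-1 : ℝ) • mix W ν := by
      rw [mix_sub, neg_one_smul, sub_eq_add_neg]
    have e3 : consensusErr (mix W ν) ≤ ∑ i, ‖ν i‖ ^ 2 - n * ‖avg ν‖ ^ 2 := by
      rw [consensusErr_eq hn, hW.avg_mix]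
      linarith [hW.sum_norm_sq_mix_le ν]
    have e4 : consensusErr (mix W g) ≤ (1 - D) * consensusErr g := by
      rw [← hl]
      exact hW.consensusErr_mix_le g
    rw [e2, consensusErr_add hn, consensusErr_smul, ← sum_inner_sub_avg_right hn,
      sum_inner_sub_avg hn, avg_smul, hW.avg_mix, hW.avg_mix]
    simp only [Pi.smul_apply, inner_smul_right, ← Finset.mul_sum]
    rw [hW.sum_inner_mix]
    linarith
  have h6 : (1 + D / 2) * ((1 - D) * consensusErr g) ≤ (1 - D / 2) * consensusErr g := by
    nlinarith [mul_nonneg (sq_nonneg D) (consensusErr_nonneg g)]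
  have h7 := mul_le_mul_of_nonneg_left h5 (show (0 : ℝ) ≤ 1 + D / 2 by linarith)
  rw [mul_add] at h7
  linarith

end Consensus

/-! ### Resampling one coordinate of a product measure -/

section Resample

variable {ι : Type*} [DecidableEq ι] {X : ι → Type*} [∀ i, MeasurableSpace (X i)]
  (ρ : ∀ i, Measure (X i)) [∀ i, IsProbabilityMeasure (ρ i)]

/-- Checked on cylinders: the preimage of a box is the box without its `k`-th side, times that side.
-/
theorem map_update_infinitePi (k : ι) :
    ((Measure.infinitePi ρ).prod (ρ k)).map (fun q => Function.update q.1 k q.2)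
      = Measure.infinitePi ρ := by
  refine Measure.eq_infinitePi ρ fun s t ht => ?_
  rw [Measure.map_apply measurable_update'
    (MeasurableSet.pi s.countable_toSet fun i _ => ht i)]
  have e : (fun q : (∀ i, X i) × X k => Function.update q.1 k q.2) ⁻¹' Set.pi s t
      = (Set.pi (s.erase k : Finset ι) t) ×ˢ (if k ∈ s then t k else Set.univ) := by
    ext q
    simp only [Set.mem_preimage, Set.mem_pi, Set.mem_prod, Finset.mem_coe, Finset.mem_erase]
    constructor
    · intro hq
      refine ⟨fun i hi => ?_, ?_⟩
      · simpa [Function.update_of_ne hi.1] using hq i hi.2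
      · split_ifs with hk
        · simpa using hq k hk
        · trivial
    · rintro ⟨h1, h2⟩ i hi
      by_cases hik : i = k
      · subst hik
        simpa [hi] using h2
      · simpa [Function.update_of_ne hik] using h1 i ⟨hik, hi⟩
  rw [e, Measure.prod_prod, Measure.infinitePi_pi _ fun i _ => ht i]
  split_ifs with hk
  · rw [Finset.prod_erase_mul _ _ hk]
  · rw [measure_univ, mul_one, Finset.erase_eq_of_notMem hk]

variable {ρ}

theorem lintegral_infinitePi_le (k : ι) {F : (∀ i, X i) → ENNReal} (hF : Measurable F)
    {c : ENNReal} (h : ∀ w, ∫⁻ v, F (Function.update w k v) ∂ρ k ≤ c) :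
    ∫⁻ w, F w ∂Measure.infinitePi ρ ≤ c := by
  have hF' : Measurable fun q : (∀ i, X i) × X k => F (Function.update q.1 k q.2) :=
    hF.comp measurable_update'
  rw [← map_update_infinitePi ρ k, lintegral_map hF measurable_update',
    lintegral_prod _ hF'.aemeasurable]
  refine (lintegral_mono h).trans ?_
  simp

/-- This is the tower property without conditional expectations: integrate coordinate `k` first,
with all others frozen. -/
theorem integral_infinitePi_eq_zero (k : ι) {F : (∀ i, X i) → ℝ}
    (hF : Integrable F (Measure.infinitePi ρ))
    (h : ∀ w, ∫ v, F (Function.update w k v) ∂ρ k = 0) :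
    ∫ w, F w ∂Measure.infinitePi ρ = 0 := by
  rw [← map_update_infinitePi ρ k] at hF ⊢
  have hF' : Integrable (fun q : (∀ i, X i) × X k => F (Function.update q.1 k q.2))
      ((Measure.infinitePi ρ).prod (ρ k)) :=
    (integrable_map_measure hF.aestronglyMeasurable measurable_update'.aemeasurable).1 hF
  rw [integral_map measurable_update'.aemeasurable hF.aestronglyMeasurable,
    integral_prod _ hF']
  simp [h]

end Resample

/-! ### Square integrable functions and bounds on expectations -/

section Expectation

variable {Ω : Type*} [MeasurableSpace Ω] {Q : Measure Ω}

theorem integrable_inner_of_memLp {F : Type*} [NormedAddCommGroup F] [InnerProductSpace ℝ F]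
    {f g : Ω → F} (hf : MemLp f 2 Q) (hg : MemLp g 2 Q) :
    Integrable (fun w => inner ℝ (f w) (g w)) Q := by
  refine ((hf.integrable_norm_pow (p := 2) two_ne_zero).add
    (hg.integrable_norm_pow (p := 2) two_ne_zero)).mono' (hf.1.inner hg.1) ?_
  refine Filter.Eventually.of_forall fun w => ?_
  have := abs_real_inner_le_norm (f w) (g w)
  simp only [Real.norm_eq_abs, Pi.add_apply]
  nlinarith [sq_nonneg (‖f w‖ - ‖g w‖), sq_nonneg ‖f w‖, sq_nonneg ‖g w‖]

theorem integrable_norm_sq_of_memLp {F : Type*} [NormedAddCommGroup F] {f : Ω → F}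
    (hf : MemLp f 2 Q) : Integrable (fun w => ‖f w‖ ^ 2) Q :=
  hf.integrable_norm_pow (p := 2) two_ne_zero

theorem lintegral_enorm_sq_le {F : Type*} [NormedAddCommGroup F] {f : Ω → F} {c : ℝ}
    (hf : MemLp f 2 Q) (h : ∫ w, ‖f w‖ ^ 2 ∂Q ≤ c) :
    ∫⁻ w, ‖f w‖ₑ ^ 2 ∂Q ≤ ENNReal.ofReal c := by
  refine le_trans (le_of_eq ?_) (ENNReal.ofReal_le_ofReal h)
  rw [ofReal_integral_eq_lintegral_ofReal (integrable_norm_sq_of_memLp hf)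
    (Filter.Eventually.of_forall fun w => sq_nonneg _)]
  refine lintegral_congr fun w => ?_
  rw [ENNReal.ofReal_pow (norm_nonneg _), ofReal_norm]

theorem memLp_two_of_lintegral_le {F : Type*} [NormedAddCommGroup F] {f : Ω → F} {c : ℝ}
    (hf : AEStronglyMeasurable f Q) (h : ∫⁻ w, ‖f w‖ₑ ^ 2 ∂Q ≤ ENNReal.ofReal c) :
    MemLp f 2 Q := by
  rw [memLp_two_iff_integrable_sq_norm hf]
  refine ⟨(hf.norm.pow 2), ?_⟩
  rw [hasFiniteIntegral_iff_enorm]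
  refine lt_of_le_of_lt (le_trans (le_of_eq ?_) h) ENNReal.ofReal_lt_top
  refine lintegral_congr fun w => ?_
  rw [enorm_pow, enorm_norm]

theorem integral_norm_sq_le {F : Type*} [NormedAddCommGroup F] {f : Ω → F} {c : ℝ} (hc : 0 ≤ c)
    (hf : MemLp f 2 Q) (h : ∫⁻ w, ‖f w‖ₑ ^ 2 ∂Q ≤ ENNReal.ofReal c) :
    ∫ w, ‖f w‖ ^ 2 ∂Q ≤ c := by
  rw [← ENNReal.ofReal_le_ofReal_iff hc, ofReal_integral_eq_lintegral_ofReal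
    (integrable_norm_sq_of_memLp hf) (Filter.Eventually.of_forall fun w => sq_nonneg _)]
  refine le_trans (le_of_eq (lintegral_congr fun w => ?_)) h
  rw [ENNReal.ofReal_pow (norm_nonneg _), ofReal_norm]

/-- `F` is integrable and its expectation is at most `c`. -/
structure ExpLE (Q : Measure Ω) (F : Ω → ℝ) (c : ℝ) : Prop where
  integrable : Integrable F Q
  le : ∫ w, F w ∂Q ≤ c

namespace ExpLE

variable {F F' : Ω → ℝ} {c c' : ℝ}

theorem mono (h : ExpLE Q F c) (hc : c ≤ c') : ExpLE Q F c' := ⟨h.1, h.2.trans hc⟩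

theorem add (h : ExpLE Q F c) (h' : ExpLE Q F' c') : ExpLE Q (fun w => F w + F' w) (c + c') :=
  ⟨h.1.add h'.1, by rw [integral_add h.1 h'.1]; exact add_le_add h.2 h'.2⟩

theorem const_mul {a : ℝ} (ha : 0 ≤ a) (h : ExpLE Q F c) : ExpLE Q (fun w => a * F w) (a * c) :=
  ⟨h.1.const_mul a, by rw [integral_const_mul]; exact mul_le_mul_of_nonneg_left h.2 ha⟩

theorem sum {ι : Type*} {s : Finset ι} {f : ι → Ω → ℝ} {c : ι → ℝ}
    (h : ∀ i ∈ s, ExpLE Q (f i) (c i)) : ExpLE Q (fun w => ∑ i ∈ s, f i w) (∑ i ∈ s, c i) :=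
  ⟨integrable_finsetSum _ fun i hi => (h i hi).1, by
    rw [integral_finsetSum _ fun i hi => (h i hi).1]
    exact Finset.sum_le_sum fun i hi => (h i hi).2⟩

end ExpLE

/-- `F` is integrable and its expectation vanishes. -/
structure ExpZero (Q : Measure Ω) (F : Ω → ℝ) : Prop where
  integrable : Integrable F Q
  eq : ∫ w, F w ∂Q = 0

namespace ExpZero

variable {F F' : Ω → ℝ}

theorem add (h : ExpZero Q F) (h' : ExpZero Q F') : ExpZero Q (fun w => F w + F' w) :=
  ⟨h.1.add h'.1, by rw [integral_add h.1 h'.1, h.2, h'.2, add_zero]⟩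

theorem const_mul (a : ℝ) (h : ExpZero Q F) : ExpZero Q (fun w => a * F w) :=
  ⟨h.1.const_mul a, by rw [integral_const_mul, h.2, mul_zero]⟩

theorem sum {ι : Type*} {s : Finset ι} {f : ι → Ω → ℝ}
    (h : ∀ i ∈ s, ExpZero Q (f i)) : ExpZero Q (fun w => ∑ i ∈ s, f i w) :=
  ⟨integrable_finsetSum _ fun i hi => (h i hi).1, by
    rw [integral_finsetSum _ fun i hi => (h i hi).1]
    exact Finset.sum_eq_zero fun i hi => (h i hi).2⟩

theorem expLE (h : ExpZero Q F) : ExpLE Q F 0 := ⟨h.1, h.2.le⟩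

end ExpZero

/-- The second moment of an average of `b` orthogonal terms. -/
theorem expLE_norm_sq_smul_sum {F : Type*} [NormedAddCommGroup F] [InnerProductSpace ℝ F] {b : ℕ}
    {e : Fin b → Ω → F} {c : ℝ} (he : ∀ j, ExpLE Q (fun w => ‖e j w‖ ^ 2) c)
    (horth : ∀ j j', j ≠ j' → ExpZero Q fun w => inner ℝ (e j w) (e j' w)) (hb : 0 < b) :
    ExpLE Q (fun w => ‖(b : ℝ)⁻¹ • ∑ j, e j w‖ ^ 2) (c / b) := by
  have h1 : (fun w => ‖(b : ℝ)⁻¹ • ∑ j, e j w‖ ^ 2)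
      = fun w => ((b : ℝ)⁻¹) ^ 2 * ∑ j, ∑ j', inner ℝ (e j w) (e j' w) := by
    ext1 w
    rw [norm_smul, mul_pow, Real.norm_eq_abs, sq_abs, ← real_inner_self_eq_norm_sq, sum_inner]
    simp_rw [inner_sum]
  rw [h1]
  have h2 : ∀ j j', ExpLE Q (fun w => inner ℝ (e j w) (e j' w)) (if j = j' then c else 0) := by
    intro j j'
    split_ifs with hj
    · subst hj
      simpa only [real_inner_self_eq_norm_sq] using he j
    · exact (horth j j' hj).expLE
  refine (ExpLE.const_mul (sq_nonneg _) (ExpLE.sum fun j _ => ExpLE.sum fun j' _ => h2 j j')).mono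
    (le_of_eq ?_)
  have : (b : ℝ) ≠ 0 := by positivity
  simp
  field_simp

end Expectation

theorem measurable_pair_fst {d k : ℕ} : Measurable fun q : Pair d k => q.fst :=
  measurable_fst.comp (WithLp.measurable_ofLp 2 (Vec d × Vec k))

theorem measurable_pair_snd {d k : ℕ} : Measurable fun q : Pair d k => q.snd :=
  measurable_snd.comp (WithLp.measurable_ofLp 2 (Vec d × Vec k))

/-! ### The algorithm driven by independent samples -/

/-- The data of the algorithm, where `ρ (t, i, j)` is the law of the `j`-th sample drawn by agent
`i` at iteration `t`. -/
structure Scheme (n d b : ℕ) (p : Fin n → ℕ) (S : Fin n → Type*) [∀ i, MeasurableSpace (S i)] where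
  (f : ∀ i, Vec d → Vec (p i) → ℝ)
  (Y : ∀ i, Set (Vec (p i)))
  (L μ σ ηx ηy : ℝ)
  (G : SimpleGraph (Fin n))
  (W : Matrix (Fin n) (Fin n) ℝ)
  (h : ∀ i, Vec d → Vec (p i) → S i → Pair d (p i))
  (x₀ : Fin n → Vec d)
  (y₀ : ∀ i, Vec (p i))
  (ρ : ∀ k : ℕ × Fin n × Fin b, Measure (S k.2.1))
  [prob : ∀ k, IsProbabilityMeasure (ρ k)]
  (b_pos : 0 < b)
  (μ_pos : 0 < μ)
  (mixing : IsMixing G W)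
  (objective : ∀ i, IsSmoothStronglyConcave (f i) (Y i) L μ)
  (convex : ∀ i, Convex ℝ (Y i))
  (compact : ∀ i, IsCompact (Y i))
  (diam_pos : ∀ i, 0 < Metric.diam (Y i))
  (measurable_h : ∀ i, Measurable fun q : Vec d × Vec (p i) × S i => h i q.1 q.2.1 q.2.2)
  (oracle : ∀ t i j, IsOracle (ρ (t, i, j)) (f i) (Y i) σ (h i) id)
  (y₀_mem : ∀ i, y₀ i ∈ Y i)

/-- The space of all samples. -/
abbrev Samples {n : ℕ} (b : ℕ) (S : Fin n → Type*) : Type _ := ∀ k : ℕ × Fin n × Fin b, S k.2.1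

/-- `Z` does not depend on the sample with index `k`. -/
def Ignores {n b : ℕ} {S : Fin n → Type*} {α : Type*} (Z : Samples b S → α)
    (k : ℕ × Fin n × Fin b) : Prop :=
  ∀ w v, Z (Function.update w k v) = Z w

theorem samples_update_eq {n b : ℕ} {S : Fin n → Type*} {k : ℕ × Fin n × Fin b} {r : ℕ} (hr : r ≠ k.1) (w : Samples b S)
    (v : S k.2.1) :
    (fun i j => Function.update w k v (r, i, j) : ∀ i, Fin b → S i) = fun i j => w (r, i, j) := by
  ext i j
  refine Function.update_of_ne ?_ _ _
  rintro rfl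
  exact hr rfl

namespace Scheme

attribute [instance] Scheme.prob

variable {n d b : ℕ} {p : Fin n → ℕ} {S : Fin n → Type*} [∀ i, MeasurableSpace (S i)]
  (A : Scheme n d b p S)

/-- The law of all samples. -/
def law : Measure (Samples b S) := Measure.infinitePi A.ρ

instance : IsProbabilityMeasure A.law := by unfold law; infer_instance

/-- The iterates. -/
def z (t : ℕ) (w : Samples b S) : State n d p :=
  iterate A.h A.Y A.W A.ηx A.ηy A.x₀ A.y₀ (fun t i j => w (t, i, j)) t

/-- The stochastic gradients at the iterates. -/
def stochGrad (t : ℕ) (w : Samples b S) (i : Fin n) : Pair d (p i) :=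
  batchGrad (A.h i) ((A.z t w).x i) ((A.z t w).y i) fun j => w (t, i, j)

/-- The gradients at the iterates. -/
def grad (t : ℕ) (w : Samples b S) (i : Fin n) : Pair d (p i) :=
  fullGrad (A.f i) ((A.z t w).x i) ((A.z t w).y i)

/-- The gradient noise of one sample. -/
def err (t : ℕ) (i : Fin n) (j : Fin b) (w : Samples b S) : Pair d (p i) :=
  A.h i ((A.z t w).x i) ((A.z t w).y i) (w (t, i, j)) - A.grad t w i

/-- The gradient noise of one batch. -/
def noise (t : ℕ) (w : Samples b S) (i : Fin n) : Pair d (p i) :=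
  A.stochGrad t w i - A.grad t w i

theorem z_zero_g (w : Samples b S) (i : Fin n) : (A.z 0 w).g i = (A.stochGrad 0 w i).fst := rfl

theorem z_succ_x (t : ℕ) (w : Samples b S) :
    (A.z (t + 1) w).x = mix A.W fun j => (A.z t w).x j - A.ηx • (A.z t w).g j := rfl

theorem z_succ_y (t : ℕ) (w : Samples b S) (i : Fin n) :
    (A.z (t + 1) w).y i = proj (A.Y i) ((A.z t w).y i + A.ηy • (A.stochGrad t w i).snd) := rfl

theorem z_succ_g (t : ℕ) (w : Samples b S) :
    (A.z (t + 1) w).g = mix A.W fun j => (A.z t w).g j + (A.stochGrad (t + 1) w j).fst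
      - (A.stochGrad t w j).fst := rfl

theorem stochGrad_eq (t : ℕ) (w : Samples b S) (i : Fin n) :
    A.stochGrad t w i = A.grad t w i + A.noise t w i := by
  rw [noise]; abel

theorem noise_eq (t : ℕ) (w : Samples b S) (i : Fin n) :
    A.noise t w i = (b : ℝ)⁻¹ • ∑ j, A.err t i j w := by
  have : (b : ℝ) ≠ 0 := by have := A.b_pos; positivity
  simp only [noise, err, stochGrad, batchGrad]
  rw [Finset.sum_sub_distrib, Finset.sum_const, Finset.card_univ, Fintype.card_fin,
    ← Nat.cast_smul_eq_nsmul ℝ, smul_sub, smul_smul, inv_mul_cancel₀ this, one_smul]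

theorem nonempty_Y (i : Fin n) : (A.Y i).Nonempty := nonempty_of_diam_pos (A.diam_pos i)

theorem y_mem (t : ℕ) (w : Samples b S) (i : Fin n) : (A.z t w).y i ∈ A.Y i := by
  cases t with
  | zero => exact A.y₀_mem i
  | succ t => exact proj_mem (A.compact i) (A.nonempty_Y i) _

/-! ### Dependence on the samples -/

/-- The asymmetry matters: $x^t$ and $y^t$ use only samples drawn before time $t$, whereas $g^t$
also uses those of time $t$. -/
theorem iterate_congr {s s' : ℕ → ∀ i, Fin b → S i} (t : ℕ) (hs : ∀ r < t, s r = s' r) :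
    (iterate A.h A.Y A.W A.ηx A.ηy A.x₀ A.y₀ s t).x
        = (iterate A.h A.Y A.W A.ηx A.ηy A.x₀ A.y₀ s' t).x ∧
      (iterate A.h A.Y A.W A.ηx A.ηy A.x₀ A.y₀ s t).y
        = (iterate A.h A.Y A.W A.ηx A.ηy A.x₀ A.y₀ s' t).y ∧
      (s t = s' t → iterate A.h A.Y A.W A.ηx A.ηy A.x₀ A.y₀ s t
        = iterate A.h A.Y A.W A.ηx A.ηy A.x₀ A.y₀ s' t) := by
  induction t with
  | zero => exact ⟨rfl, rfl, fun h => by simp only [iterate, h]⟩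
  | succ t ih =>
    have h1 := (ih fun r hr => hs r (hr.trans (Nat.lt_succ_self t))).2.2 (hs t (Nat.lt_succ_self t))
    have h2 := hs t (Nat.lt_succ_self t)
    refine ⟨?_, ?_, fun h3 => ?_⟩
    · simp only [iterate, h1]
    · simp only [iterate, h1, h2]
    · simp only [iterate, h1, h2, h3]

theorem ignores_x {t : ℕ} {k : ℕ × Fin n × Fin b} (hk : t ≤ k.1) :
    Ignores (fun w => (A.z t w).x) k := fun w v =>
  (A.iterate_congr t fun _ hr => samples_update_eq (hr.trans_le hk).ne w v).1

theorem ignores_y {t : ℕ} {k : ℕ × Fin n × Fin b} (hk : t ≤ k.1) :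
    Ignores (fun w => (A.z t w).y) k := fun w v =>
  (A.iterate_congr t fun _ hr => samples_update_eq (hr.trans_le hk).ne w v).2.1

theorem ignores_z {t : ℕ} {k : ℕ × Fin n × Fin b} (hk : t < k.1) :
    Ignores (A.z t) k := fun w v =>
  (A.iterate_congr t fun _ hr => samples_update_eq (hr.trans hk).ne w v).2.2
    (samples_update_eq hk.ne w v)

theorem ignores_grad {t : ℕ} {k : ℕ × Fin n × Fin b} (hk : t ≤ k.1) :
    Ignores (A.grad t) k := fun w v => by
  have h1 := A.ignores_x hk w v
  have h2 := A.ignores_y hk w v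
  simp only at h1 h2
  ext1 i
  rw [grad, grad, h1, h2]

theorem ignores_err {t : ℕ} {i : Fin n} {j : Fin b} {k : ℕ × Fin n × Fin b} (hk : t ≤ k.1)
    (hne : (t, i, j) ≠ k) : Ignores (A.err t i j) k := fun w v => by
  have h1 := A.ignores_x hk w v
  have h2 := A.ignores_y hk w v
  simp only at h1 h2
  rw [err, err, h1, h2, A.ignores_grad hk w v, Function.update_of_ne hne]

theorem ignores_noise {t : ℕ} {i : Fin n} {k : ℕ × Fin n × Fin b} (hk : t ≤ k.1)
    (hne : t = k.1 → i ≠ k.2.1) : Ignores (fun w => A.noise t w i) k := fun w v => by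
  simp only [noise_eq]
  refine congrArg _ (Finset.sum_congr rfl fun j _ => A.ignores_err hk ?_ w v)
  rintro rfl
  exact hne rfl rfl

/-! ### Measurability -/

theorem measurable_oracle {x : Samples b S → Vec d} {i : Fin n} {y : Samples b S → Vec (p i)}
    (hx : Measurable x) (hy : Measurable y) (t : ℕ) (j : Fin b) :
    Measurable fun w : Samples b S => A.h i (x w) (y w) (w (t, i, j)) :=
  (A.measurable_h i).comp (hx.prodMk (hy.prodMk (measurable_pi_apply (t, i, j))))

theorem measurable_z (t : ℕ) :
    (∀ i, Measurable fun w => (A.z t w).x i) ∧ (∀ i, Measurable fun w => (A.z t w).y i) ∧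
      ∀ i, Measurable fun w => (A.z t w).g i := by
  have hG : ∀ t, (∀ i, Measurable fun w => (A.z t w).x i) →
      (∀ i, Measurable fun w => (A.z t w).y i) → ∀ i, Measurable fun w => A.stochGrad t w i := by
    intro t hx hy i
    exact (Finset.measurable_fun_sum Finset.univ fun j _ =>
      A.measurable_oracle (hx i) (hy i) t j).fun_const_smul (b : ℝ)⁻¹
  induction t with
  | zero =>
    refine ⟨fun i => measurable_const, fun i => measurable_const, fun i => ?_⟩
    exact measurable_pair_fst.comp
      (hG 0 (fun i => measurable_const) (fun i => measurable_const) i)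
  | succ t ih =>
    obtain ⟨hx, hy, hg⟩ := ih
    have hx' : ∀ i, Measurable fun w => (A.z (t + 1) w).x i := by
      intro i
      simp only [z_succ_x, mix]
      exact Finset.measurable_fun_sum _ fun j _ =>
        ((hx j).fun_sub ((hg j).fun_const_smul _)).fun_const_smul _
    have hy' : ∀ i, Measurable fun w => (A.z (t + 1) w).y i := by
      intro i
      simp only [z_succ_y]
      exact (continuous_proj (A.convex i) (A.compact i) (A.nonempty_Y i)).measurable.comp
        ((hy i).fun_add ((measurable_pair_snd.comp (hG t hx hy i)).fun_const_smul A.ηy))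
    refine ⟨hx', hy', fun i => ?_⟩
    simp only [z_succ_g, mix]
    exact Finset.measurable_fun_sum _ fun j _ => (((hg j).fun_add
      (measurable_pair_fst.comp (hG (t + 1) hx' hy' j))).fun_sub
      (measurable_pair_fst.comp (hG t hx hy j))).fun_const_smul _

/-- By unbiasedness the gradient is a parametric integral of the jointly measurable oracle; any
sample of the batch serves. -/
theorem measurable_grad (t : ℕ) (i : Fin n) : Measurable fun w => A.grad t w i := by
  have j : Fin b := ⟨0, A.b_pos⟩
  have h1 : (fun w => A.grad t w i) = fun w =>
      ∫ v, A.h i ((A.z t w).x i) ((A.z t w).y i) v ∂A.ρ (t, i, j) := by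
    ext1 w
    exact ((A.oracle t i j).unbiased _ _ (A.y_mem t w i)).symm
  rw [h1]
  have h2 : Measurable fun q : Samples b S × S i =>
      A.h i ((A.z t q.1).x i) ((A.z t q.1).y i) q.2 :=
    (A.measurable_h i).comp ((((A.measurable_z t).1 i).comp measurable_fst).prodMk
      ((((A.measurable_z t).2.1 i).comp measurable_fst).prodMk measurable_snd))
  exact (h2.stronglyMeasurable.integral_prod_right' (ν := A.ρ (t, i, j))).measurable

theorem measurable_err (t : ℕ) (i : Fin n) (j : Fin b) : Measurable (A.err t i j) :=
  (A.measurable_oracle ((A.measurable_z t).1 i) ((A.measurable_z t).2.1 i) t j).sub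
    (A.measurable_grad t i)

/-! ### Moments -/

theorem err_update (t : ℕ) (i : Fin n) (j : Fin b) (w : Samples b S) (v : S i) :
    A.err t i j (Function.update w (t, i, j) v)
      = A.h i ((A.z t w).x i) ((A.z t w).y i) v - A.grad t w i := by
  have h1 := A.ignores_x (k := (t, i, j)) le_rfl w v
  have h2 := A.ignores_y (k := (t, i, j)) le_rfl w v
  simp only at h1 h2
  rw [err, h1, h2, A.ignores_grad (k := (t, i, j)) le_rfl w v, Function.update_self]

/-- With the other samples frozen, the iterate is a fixed point of the domain and the variance bound
applies uniformly. Working with `∫⁻` makes square integrability a consequence instead of a premise.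
-/
theorem lintegral_err_le (t : ℕ) (i : Fin n) (j : Fin b) :
    ∫⁻ w, ‖A.err t i j w‖ₑ ^ 2 ∂A.law ≤ ENNReal.ofReal (A.σ ^ 2) := by
  refine lintegral_infinitePi_le (t, i, j) ((A.measurable_err t i j).enorm.pow_const 2) fun w => ?_
  simp only [err_update]
  have ho := A.oracle t i j
  exact lintegral_enorm_sq_le ((ho.memLp _ _ (A.y_mem t w i)).sub (memLp_const _))
    (ho.variance _ _ (A.y_mem t w i))

theorem memLp_err (t : ℕ) (i : Fin n) (j : Fin b) : MemLp (A.err t i j) 2 A.law :=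
  memLp_two_of_lintegral_le (A.measurable_err t i j).aestronglyMeasurable (A.lintegral_err_le t i j)

theorem expLE_norm_sq_err (t : ℕ) (i : Fin n) (j : Fin b) :
    ExpLE A.law (fun w => ‖A.err t i j w‖ ^ 2) (A.σ ^ 2) :=
  ⟨integrable_norm_sq_of_memLp (A.memLp_err t i j),
    integral_norm_sq_le (sq_nonneg _) (A.memLp_err t i j) (A.lintegral_err_le t i j)⟩

/-- When only the sample `(t, i, j)` varies, `Z` is constant and the error averages to zero by
unbiasedness. -/
theorem expZero_inner_err {t : ℕ} {i : Fin n} {j : Fin b} {Z : Samples b S → Pair d (p i)}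
    (hZ : MemLp Z 2 A.law) (hi : Ignores Z (t, i, j)) :
    ExpZero A.law fun w => inner ℝ (Z w) (A.err t i j w) := by
  have h1 := integrable_inner_of_memLp hZ (A.memLp_err t i j)
  refine ⟨h1, integral_infinitePi_eq_zero (t, i, j) h1 fun w => ?_⟩
  have ho := A.oracle t i j
  have hm := (ho.memLp ((A.z t w).x i) _ (A.y_mem t w i)).integrable one_le_two
  simp only [id] at hm
  simp only [err_update]
  have h2 : ∀ v, Z (Function.update w (t, i, j) v) = Z w := hi w
  simp only [h2]
  have h4 : Integrable (fun v => A.h i ((A.z t w).x i) ((A.z t w).y i) v - A.grad t w i)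
      (A.ρ (t, i, j)) := hm.sub (integrable_const _)
  rw [integral_inner h4, integral_sub hm (integrable_const _)]
  have h3 := ho.unbiased ((A.z t w).x i) _ (A.y_mem t w i)
  simp only [id] at h3
  rw [h3, integral_const]
  simp [grad]

theorem memLp_noise (t : ℕ) (i : Fin n) : MemLp (fun w => A.noise t w i) 2 A.law := by
  simp only [noise_eq]
  exact (memLp_finsetSum _ fun j _ => A.memLp_err t i j).const_smul (b : ℝ)⁻¹

theorem expLE_norm_sq_noise (t : ℕ) (i : Fin n) :
    ExpLE A.law (fun w => ‖A.noise t w i‖ ^ 2) (A.σ ^ 2 / b) := by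
  simp only [noise_eq]
  refine expLE_norm_sq_smul_sum (fun j => A.expLE_norm_sq_err t i j) (fun j j' hj => ?_) A.b_pos
  refine A.expZero_inner_err (A.memLp_err t i j) (A.ignores_err le_rfl ?_)
  simpa using hj

theorem expZero_inner_noise {t : ℕ} {i : Fin n} {Z : Samples b S → Pair d (p i)}
    (hZ : MemLp Z 2 A.law) (hi : ∀ j, Ignores Z (t, i, j)) :
    ExpZero A.law fun w => inner ℝ (Z w) (A.noise t w i) := by
  have h1 : (fun w => inner ℝ (Z w) (A.noise t w i))
      = fun w => (b : ℝ)⁻¹ * ∑ j, inner ℝ (Z w) (A.err t i j w) := by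
    ext1 w
    rw [noise_eq, inner_smul_right, inner_sum]
  rw [h1]
  exact (ExpZero.sum fun j _ => A.expZero_inner_err hZ (hi j)).const_mul _

end Scheme

/-! ### Square integrability of the components of a pair -/

section Pair

variable {d k : ℕ} {Ω : Type*} [MeasurableSpace Ω] {Q : Measure Ω}

theorem memLp_pair_fst {Z : Ω → Pair d k} (hZ : MemLp Z 2 Q) : MemLp (fun w => (Z w).fst) 2 Q :=
  hZ.mono (measurable_pair_fst.comp_aemeasurable hZ.1.aemeasurable).aestronglyMeasurable
    (Filter.Eventually.of_forall fun _ => norm_fst_le_pair _)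

theorem memLp_pair_snd {Z : Ω → Pair d k} (hZ : MemLp Z 2 Q) : MemLp (fun w => (Z w).snd) 2 Q :=
  hZ.mono (measurable_pair_snd.comp_aemeasurable hZ.1.aemeasurable).aestronglyMeasurable
    (Filter.Eventually.of_forall fun _ => norm_snd_le_pair _)

theorem memLp_toLp_fst {Z : Ω → Vec d} (hZ : MemLp Z 2 Q) :
    MemLp (fun w => (WithLp.toLp 2 (Z w, 0) : Pair d k)) 2 Q := by
  refine hZ.mono ?_ (Filter.Eventually.of_forall fun w => ?_)
  · exact ((WithLp.measurable_toLp 2 (Vec d × Vec k)).comp_aemeasurable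
      (hZ.1.aemeasurable.prodMk aemeasurable_const)).aestronglyMeasurable
  · refine le_of_sq_le_sq ?_ (norm_nonneg _)
    rw [WithLp.prod_norm_sq_eq_of_L2]
    simp

theorem memLp_toLp_snd {Z : Ω → Vec k} (hZ : MemLp Z 2 Q) :
    MemLp (fun w => (WithLp.toLp 2 (0, Z w) : Pair d k)) 2 Q := by
  refine hZ.mono ?_ (Filter.Eventually.of_forall fun w => ?_)
  · exact ((WithLp.measurable_toLp 2 (Vec d × Vec k)).comp_aemeasurable
      (aemeasurable_const.prodMk hZ.1.aemeasurable)).aestronglyMeasurable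
  · refine le_of_sq_le_sq ?_ (norm_nonneg _)
    rw [WithLp.prod_norm_sq_eq_of_L2]
    simp

theorem ExpLE.mono_fun {F F' : Ω → ℝ} {c : ℝ} (h : ExpLE Q F c) (hF' : Integrable F' Q)
    (hle : ∀ w, F' w ≤ F w) : ExpLE Q F' c :=
  ⟨hF', (integral_mono hF' h.1 hle).trans h.2⟩

end Pair

namespace Scheme

variable {n d b : ℕ} {p : Fin n → ℕ} {S : Fin n → Type*} [∀ i, MeasurableSpace (S i)]
  (A : Scheme n d b p S)

theorem μ_le_L : A.μ ≤ A.L :=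
  A.objective ⟨0, A.mixing.pos⟩ |>.le_smoothness (A.diam_pos _)

theorem L_pos : 0 < A.L := A.μ_pos.trans_le A.μ_le_L

/-! ### Square integrability of the iterates -/

theorem memLp_y (t : ℕ) (i : Fin n) : MemLp (fun w => (A.z t w).y i) 2 A.law := by
  obtain ⟨C, hC⟩ := (A.compact i).isBounded.exists_norm_le
  exact MemLp.of_bound ((A.measurable_z t).2.1 i).aestronglyMeasurable C
    (Filter.Eventually.of_forall fun w => hC _ (A.y_mem t w i))

/-- The Lipschitz condition gives linear growth in `x`, and `y` stays in a compact set. -/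
theorem memLp_grad_of_memLp_x {t : ℕ} {i : Fin n}
    (hx : MemLp (fun w => (A.z t w).x i) 2 A.law) : MemLp (fun w => A.grad t w i) 2 A.law := by
  have hy : MemLp (fun w => (A.z t w).y i - A.y₀ i) 2 A.law :=
    (A.memLp_y t i).sub (memLp_const (A.y₀ i))
  have h1 : MemLp (fun w => ‖fullGrad (A.f i) 0 (A.y₀ i)‖
      + A.L * (‖(A.z t w).x i‖ + ‖(A.z t w).y i - A.y₀ i‖)) 2 A.law :=
    (memLp_const ‖fullGrad (A.f i) 0 (A.y₀ i)‖).add ((hx.norm.add hy.norm).const_mul A.L)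
  refine h1.mono (A.measurable_grad t i).aestronglyMeasurable
    (Filter.Eventually.of_forall fun w => ?_)
  have h2 := (A.objective i).smooth ((A.z t w).x i) 0 _ (A.y_mem t w i) _ (A.y₀_mem i)
  rw [sub_zero] at h2
  have h3 := norm_le_norm_add_norm_sub (fullGrad (A.f i) 0 (A.y₀ i)) (A.grad t w i)
  rw [norm_sub_rev] at h3
  refine (h3.trans (add_le_add_right h2 _)).trans (le_abs_self _)

theorem memLp_z (t : ℕ) : (∀ i, MemLp (fun w => (A.z t w).x i) 2 A.law) ∧
    ∀ i, MemLp (fun w => (A.z t w).g i) 2 A.law := by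
  have hG : ∀ t, (∀ i, MemLp (fun w => (A.z t w).x i) 2 A.law) →
      ∀ i, MemLp (fun w => (A.stochGrad t w i).fst) 2 A.law := by
    intro t hx i
    simp only [stochGrad_eq]
    exact memLp_pair_fst ((A.memLp_grad_of_memLp_x (hx i)).add (A.memLp_noise t i))
  induction t with
  | zero => exact ⟨fun i => memLp_const _, hG 0 fun i => memLp_const _⟩
  | succ t ih =>
    obtain ⟨hx, hg⟩ := ih
    have hx' : ∀ i, MemLp (fun w => (A.z (t + 1) w).x i) 2 A.law := by
      intro i
      simp only [z_succ_x, mix]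
      exact memLp_finsetSum _ fun j _ => ((hx j).sub ((hg j).const_smul A.ηx)).const_smul (A.W i j)
    refine ⟨hx', fun i => ?_⟩
    simp only [z_succ_g, mix]
    exact memLp_finsetSum _ fun j _ =>
      (((hg j).add (hG (t + 1) hx' j)).sub (hG t hx j)).const_smul (A.W i j)

theorem memLp_x (t : ℕ) (i : Fin n) : MemLp (fun w => (A.z t w).x i) 2 A.law := (A.memLp_z t).1 i

theorem memLp_g (t : ℕ) (i : Fin n) : MemLp (fun w => (A.z t w).g i) 2 A.law := (A.memLp_z t).2 i

theorem memLp_grad (t : ℕ) (i : Fin n) : MemLp (fun w => A.grad t w i) 2 A.law :=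
  A.memLp_grad_of_memLp_x (A.memLp_x t i)

theorem memLp_mix {Ω : Type*} [MeasurableSpace Ω] {Q : Measure Ω} (W : Matrix (Fin n) (Fin n) ℝ)
    {v : Ω → Fin n → Vec d} (hv : ∀ i, MemLp (fun w => v w i) 2 Q) (i : Fin n) :
    MemLp (fun w => mix W (v w) i) 2 Q :=
  memLp_finsetSum _ fun j _ => (hv j).const_smul (W i j)

theorem memLp_avg {Ω : Type*} [MeasurableSpace Ω] {Q : Measure Ω}
    {v : Ω → Fin n → Vec d} (hv : ∀ i, MemLp (fun w => v w i) 2 Q) :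
    MemLp (fun w => avg (v w)) 2 Q :=
  (memLp_finsetSum _ fun j _ => hv j).const_smul (n : ℝ)⁻¹

/-! ### The components of the noise -/

/-- The noise of the primal gradients. -/
def noiseX (t : ℕ) (w : Samples b S) (i : Fin n) : Vec d := (A.noise t w i).fst

/-- The noise of the dual gradients. -/
def noiseY (t : ℕ) (w : Samples b S) (i : Fin n) : Vec (p i) := (A.noise t w i).snd

theorem memLp_noiseX (t : ℕ) (i : Fin n) : MemLp (fun w => A.noiseX t w i) 2 A.law :=
  memLp_pair_fst (A.memLp_noise t i)

theorem memLp_noiseY (t : ℕ) (i : Fin n) : MemLp (fun w => A.noiseY t w i) 2 A.law :=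
  memLp_pair_snd (A.memLp_noise t i)

theorem expZero_inner_noiseX {t : ℕ} {i : Fin n} {Z : Samples b S → Vec d}
    (hZ : MemLp Z 2 A.law) (hi : ∀ j, Ignores Z (t, i, j)) :
    ExpZero A.law fun w => inner ℝ (Z w) (A.noiseX t w i) := by
  -- Testing against $(Z,0)$ isolates the first component of the noise.
  have := A.expZero_inner_noise (t := t) (i := i) (memLp_toLp_fst hZ)
    fun j _ _ => by rw [hi j]
  simpa [WithLp.prod_inner_apply, noiseX] using this

theorem expZero_inner_noiseY {t : ℕ} {i : Fin n} {Z : Samples b S → Vec (p i)}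
    (hZ : MemLp Z 2 A.law) (hi : ∀ j, Ignores Z (t, i, j)) :
    ExpZero A.law fun w => inner ℝ (Z w) (A.noiseY t w i) := by
  have := A.expZero_inner_noise (t := t) (i := i) (memLp_toLp_snd hZ)
    fun j _ _ => by rw [hi j]
  simpa [WithLp.prod_inner_apply, noiseY] using this

theorem expLE_norm_sq_noiseX (t : ℕ) (i : Fin n) :
    ExpLE A.law (fun w => ‖A.noiseX t w i‖ ^ 2) (A.σ ^ 2 / b) :=
  (A.expLE_norm_sq_noise t i).mono_fun (integrable_norm_sq_of_memLp (A.memLp_noiseX t i))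
    fun _ => pow_le_pow_left₀ (norm_nonneg _) (norm_fst_le_pair _) 2

theorem expLE_norm_sq_noiseY (t : ℕ) (i : Fin n) :
    ExpLE A.law (fun w => ‖A.noiseY t w i‖ ^ 2) (A.σ ^ 2 / b) :=
  (A.expLE_norm_sq_noise t i).mono_fun (integrable_norm_sq_of_memLp (A.memLp_noiseY t i))
    fun _ => pow_le_pow_left₀ (norm_nonneg _) (norm_snd_le_pair _) 2

theorem expZero_inner_noiseX_noiseX (t : ℕ) {i j : Fin n} (hij : i ≠ j) :
    ExpZero A.law fun w => inner ℝ (A.noiseX t w i) (A.noiseX t w j) := by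
  refine A.expZero_inner_noiseX (A.memLp_noiseX t i) fun l w v => ?_
  have := A.ignores_noise (t := t) (i := i) (k := (t, j, l)) le_rfl (fun _ => hij) w v
  simp only at this
  rw [noiseX, this, noiseX]

/-- Noises of different agents are orthogonal, so averaging gains the factor $1/n$. -/
theorem expLE_norm_sq_avg_noiseX (t : ℕ) :
    ExpLE A.law (fun w => ‖avg (A.noiseX t w)‖ ^ 2) (A.σ ^ 2 / b / n) :=
  expLE_norm_sq_smul_sum (fun i => A.expLE_norm_sq_noiseX t i)
    (fun _ _ hij => A.expZero_inner_noiseX_noiseX t hij) A.mixing.pos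

theorem expLE_neg_inner_noiseX_noiseX (t : ℕ) (i j : Fin n) :
    ExpLE A.law (fun w => -1 * inner ℝ (A.noiseX t w i) (A.noiseX t w j)) 0 := by
  by_cases hij : i = j
  · subst hij
    have h := (integrable_norm_sq_of_memLp (A.memLp_noiseX t i)).const_mul (-1)
    simp only [real_inner_self_eq_norm_sq]
    refine ⟨h, integral_nonpos fun w => ?_⟩
    simp
  · exact ((A.expZero_inner_noiseX_noiseX t hij).const_mul (-1)).expLE

theorem ignores_noiseX_of_lt {t : ℕ} {k : ℕ × Fin n × Fin b} (hk : t < k.1) :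
    Ignores (A.noiseX t) k := fun w v => by
  ext1 i
  have := A.ignores_noise (t := t) (i := i) (k := k) hk.le (fun h => absurd h hk.ne) w v
  simp only at this
  rw [noiseX, this, noiseX]

/-- The tracker contains the current noise of the agents with nonnegative coefficients. Its product
with the noise of agent `j` therefore has, in expectation, only the contribution of a nonnegative
multiple of $\|\nu_j\|^2$; everything else is orthogonal. -/
theorem expLE_neg_inner_g_noiseX (t : ℕ) (i j : Fin n) :
    ExpLE A.law (fun w => -1 * inner ℝ ((A.z t w).g i) (A.noiseX t w j)) 0 := by
  cases t with
  | zero =>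
    have h1 := ((A.expZero_inner_noiseX (t := 0) (i := j) (memLp_pair_fst (A.memLp_grad 0 i))
      fun l w v => by rw [A.ignores_grad (k := (0, j, l)) le_rfl w v]).const_mul (-1)).expLE.add
      (A.expLE_neg_inner_noiseX_noiseX 0 i j)
    rw [add_zero] at h1
    convert h1 using 2
    rw [z_zero_g, stochGrad_eq, WithLp.add_fst, inner_add_left, noiseX, noiseX]
    ring
  | succ t =>
    -- The vector that `W` mixes into $g^{t+1}$, minus the noise of time `t + 1`; hence independent
    -- of the samples of that time.
    set r : Samples b S → Fin n → Vec d := fun w l =>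
      (A.z t w).g l + (A.grad (t + 1) w l).fst - ((A.grad t w l).fst + A.noiseX t w l) with hr
    have hr2 : ∀ l, MemLp (fun w => r w l) 2 A.law := fun l =>
      ((A.memLp_g t l).add (memLp_pair_fst (A.memLp_grad (t + 1) l))).sub
        ((memLp_pair_fst (A.memLp_grad t l)).add (A.memLp_noiseX t l))
    have hri : ∀ l m, Ignores (fun w => r w l) (t + 1, j, m) := by
      intro l m w v
      simp only [hr]
      rw [A.ignores_z (k := (t + 1, j, m)) (Nat.lt_succ_self t) w v,
        A.ignores_grad (k := (t + 1, j, m)) le_rfl w v,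
        A.ignores_grad (k := (t + 1, j, m)) (Nat.le_succ t) w v,
        A.ignores_noiseX_of_lt (k := (t + 1, j, m)) (Nat.lt_succ_self t) w v]
    have h1 : ∀ l, ExpLE A.law (fun w => A.W i l * (-1 * inner ℝ (r w l) (A.noiseX (t + 1) w j)
        + -1 * inner ℝ (A.noiseX (t + 1) w l) (A.noiseX (t + 1) w j))) (A.W i l * (0 + 0)) :=
      fun l => ((((A.expZero_inner_noiseX (hr2 l) (hri l)).const_mul (-1)).expLE).add
        (A.expLE_neg_inner_noiseX_noiseX (t + 1) l j)).const_mul (A.mixing.nonneg i l)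
    have h2 := ExpLE.sum (s := Finset.univ) fun l _ => h1 l
    simp only [add_zero, mul_zero, Finset.sum_const_zero] at h2
    convert h2 using 2
    rw [z_succ_g, mix, sum_inner, Finset.mul_sum]
    refine Finset.sum_congr rfl fun l _ => ?_
    rw [inner_smul_left, stochGrad_eq, stochGrad_eq, WithLp.add_fst, WithLp.add_fst]
    simp only [hr, noiseX, inner_add_left, inner_sub_left, conj_trivial]
    ring

/-! ### The primal function -/

theorem n_pos (A : Scheme n d b p S) : (0 : ℝ) < n := by exact_mod_cast A.mixing.pos

/-- The maximizers `ŷᵢ(x)`. -/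
def best (x : Vec d) (i : Fin n) : Vec (p i) := argmaxOn (A.f i) (A.Y i) x

/-- The gradient of the primal function. -/
def primalGrad (x : Vec d) : Vec d := avg fun i => (fullGrad (A.f i) x (A.best x i)).fst

theorem best_mem (x : Vec d) (i : Fin n) : A.best x i ∈ A.Y i :=
  ((A.objective i).argmaxOn_spec (A.compact i) (A.nonempty_Y i) x).1

theorem norm_best_sub_le (x x' : Vec d) (i : Fin n) :
    ‖A.best x i - A.best x' i‖ ≤ A.L / A.μ * ‖x - x'‖ :=
  (A.objective i).norm_argmaxOn_sub_le A.μ_pos A.L_pos.le (A.convex i) (A.compact i)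
    (A.nonempty_Y i) x x'

theorem hasGradientAt_primal (x : Vec d) :
    HasGradientAt (primal A.f A.Y) (A.primalGrad x) x := by
  rw [hasGradientAt_iff_hasFDerivAt]
  have h1 := (HasFDerivAt.fun_sum (u := Finset.univ) fun i _ =>
    ((A.objective i).hasGradientAt_maxValue A.μ_pos A.L_pos.le (A.convex i) (A.compact i)
      (A.nonempty_Y i) x).hasFDerivAt).const_mul (n : ℝ)⁻¹
  refine h1.congr_fderiv ?_
  ext v
  simp only [primalGrad, best, avg, map_smul, map_sum]

theorem gradient_primal (x : Vec d) : gradient (primal A.f A.Y) x = A.primalGrad x :=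
  (A.hasGradientAt_primal x).gradient

theorem norm_avg_le_of_le {v : Fin n → Vec d} {c : ℝ} (hn : (0 : ℝ) < n) (hv : ∀ i, ‖v i‖ ≤ c) :
    ‖avg v‖ ≤ c := by
  rw [avg, norm_smul, Real.norm_of_nonneg (by positivity), inv_mul_eq_div, div_le_iff₀ hn]
  refine (norm_sum_le _ _).trans ((Finset.sum_le_sum fun i _ => hv i).trans (le_of_eq ?_))
  simp [mul_comm]

theorem norm_primalGrad_sub_le (x x' : Vec d) :
    ‖A.primalGrad x - A.primalGrad x'‖ ≤ A.L * (1 + A.L / A.μ) * ‖x - x'‖ := by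
  rw [primalGrad, primalGrad, ← avg_sub]
  exact norm_avg_le_of_le A.n_pos fun i => (A.objective i).norm_fst_grad_argmaxOn_sub_le A.μ_pos
    A.L_pos.le (A.convex i) (A.compact i) (A.nonempty_Y i) x x'

/-- The gradient is $L(1+\kappa)$-Lipschitz, and $(1+\kappa)/2\le\kappa$ because $\kappa\ge1$. -/
theorem abs_primal_sub_le (x x' : Vec d) :
    |primal A.f A.Y x' - primal A.f A.Y x - inner ℝ (A.primalGrad x) (x' - x)|
      ≤ A.L / A.μ * A.L * ‖x' - x‖ ^ 2 := by
  refine (abs_sub_sub_inner_le_of_gradient A.hasGradientAt_primal A.norm_primalGrad_sub_le x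
    x').trans (mul_le_mul_of_nonneg_right ?_ (sq_nonneg _))
  have h1 : 1 ≤ A.L / A.μ := (one_le_div A.μ_pos).2 A.μ_le_L
  nlinarith [A.L_pos]

/-! ### One step of the algorithm -/

/-- The average of the local primal gradients. -/
def meanGrad (t : ℕ) (w : Samples b S) : Vec d := avg fun i => (A.grad t w i).fst

theorem stochGrad_fst (t : ℕ) (w : Samples b S) :
    (fun i => (A.stochGrad t w i).fst) = (fun i => (A.grad t w i).fst) + A.noiseX t w := by
  ext1 i
  rw [stochGrad_eq, WithLp.add_fst, Pi.add_apply, noiseX]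

/-- The invariant of gradient tracking: mixing preserves means and the increments telescope, so the
mean tracker is always the mean stochastic gradient. -/
theorem avg_g (t : ℕ) (w : Samples b S) :
    avg (A.z t w).g = A.meanGrad t w + avg (A.noiseX t w) := by
  have key : avg (A.z t w).g = avg fun i => (A.stochGrad t w i).fst := by
    induction t with
    | zero => rfl
    | succ t ih =>
      have e : (fun j => (A.z t w).g j + (A.stochGrad (t + 1) w j).fst - (A.stochGrad t w j).fst)
          = (A.z t w).g + (fun j => (A.stochGrad (t + 1) w j).fst)
            - fun j => (A.stochGrad t w j).fst := rfl
      rw [z_succ_g, A.mixing.avg_mix, e, avg_sub, avg_add, ih]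
      abel
  rw [key, stochGrad_fst, avg_add, meanGrad]

theorem avg_x_succ (t : ℕ) (w : Samples b S) :
    avg (A.z (t + 1) w).x = avg (A.z t w).x - A.ηx • avg (A.z t w).g := by
  have e : (fun j => (A.z t w).x j - A.ηx • (A.z t w).g j)
      = (A.z t w).x - A.ηx • (A.z t w).g := rfl
  rw [z_succ_x, A.mixing.avg_mix, e, avg_sub, avg_smul]

theorem norm_sq_primalGrad_sub_meanGrad_le (t : ℕ) (w : Samples b S) :
    ‖A.primalGrad (avg (A.z t w).x) - A.meanGrad t w‖ ^ 2
      ≤ 2 * A.L ^ 2 / n * (consensusErr (A.z t w).x + dualErr A.f A.Y (A.z t w)) := by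
  rw [primalGrad, meanGrad, ← avg_sub]
  refine (norm_sq_avg_le A.mixing.pos _).trans ?_
  rw [consensusErr, dualErr, ← Finset.sum_add_distrib, Finset.mul_sum, Finset.mul_sum]
  refine Finset.sum_le_sum fun i _ => ?_
  have h1 := (A.objective i).smooth (avg (A.z t w).x) ((A.z t w).x i) _
    (A.best_mem (avg (A.z t w).x) i) _ (A.y_mem t w i)
  have h2 := (norm_fst_le_pair _).trans h1
  rw [WithLp.sub_fst, norm_sub_rev (avg (A.z t w).x)] at h2
  have h3 := pow_le_pow_left₀ (norm_nonneg _) h2 2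
  rw [Pi.sub_apply, grad, mul_comm (2 * A.L ^ 2 / n), mul_div_assoc', ← div_eq_inv_mul]
  refine div_le_div_of_nonneg_right (h3.trans ?_) A.n_pos.le
  rw [best]
  nlinarith [mul_nonneg (sq_nonneg A.L) (sq_nonneg (‖(A.z t w).x i - avg (A.z t w).x‖
    - ‖argmaxOn (A.f i) (A.Y i) (avg (A.z t w).x) - (A.z t w).y i‖))]

/-- The descent lemma plus polarization of the inner product of the two gradients. Polarization
produces $-\frac{\eta_x}2\|\cdot\|^2$ of the mean gradient, which absorbs the squared-step terms of
the other inequalities. -/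
theorem primal_step_le (hη : 0 ≤ A.ηx) (t : ℕ) (w : Samples b S) :
    primal A.f A.Y (avg (A.z (t + 1) w).x) ≤ primal A.f A.Y (avg (A.z t w).x)
      - A.ηx / 2 * ‖A.primalGrad (avg (A.z t w).x)‖ ^ 2 - A.ηx / 2 * ‖A.meanGrad t w‖ ^ 2
      + A.ηx * A.L ^ 2 / n * (consensusErr (A.z t w).x + dualErr A.f A.Y (A.z t w))
      - A.ηx * inner ℝ (A.primalGrad (avg (A.z t w).x)) (avg (A.noiseX t w))
      + A.L / A.μ * A.L * A.ηx ^ 2 * ‖avg (A.z t w).g‖ ^ 2 := by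
  have h1 := (abs_le.1 (A.abs_primal_sub_le (avg (A.z t w).x) (avg (A.z (t + 1) w).x))).2
  have h2 := mul_le_mul_of_nonneg_left (A.norm_sq_primalGrad_sub_meanGrad_le t w)
    (show 0 ≤ A.ηx / 2 by linarith)
  have e1 : avg (A.z (t + 1) w).x - avg (A.z t w).x = -(A.ηx • avg (A.z t w).g) := by
    rw [avg_x_succ]; abel
  rw [e1, norm_neg, norm_smul, mul_pow, Real.norm_eq_abs, sq_abs, inner_neg_right,
    inner_smul_right] at h1
  have e2 : inner ℝ (A.primalGrad (avg (A.z t w).x)) (avg (A.z t w).g)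
      = inner ℝ (A.primalGrad (avg (A.z t w).x)) (A.meanGrad t w)
        + inner ℝ (A.primalGrad (avg (A.z t w).x)) (avg (A.noiseX t w)) := by
    rw [avg_g, inner_add_right]
  rw [e2] at h1
  rw [norm_sub_sq_real] at h2
  have e3 : A.ηx / 2 * (2 * A.L ^ 2 / n * (consensusErr (A.z t w).x + dualErr A.f A.Y (A.z t w)))
      = A.ηx * A.L ^ 2 / n * (consensusErr (A.z t w).x + dualErr A.f A.Y (A.z t w)) := by ring
  rw [e3] at h2
  linarith

/-- The squared distance between consecutive dual iterates. -/
def dualStep (t : ℕ) (w : Samples b S) : ℝ := ∑ i, ‖(A.z (t + 1) w).y i - (A.z t w).y i‖ ^ 2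

/-- First ascend towards the maximizer at the old mean, then move the target. Young's inequality
with parameter $\eta_y\mu/2$ costs exactly the factor on the left of `norm_sq_ascent_step_le`, and
the drift is $\kappa\eta_x\|\bar g\|$ at most. -/
theorem dual_step_le (hη : 0 < A.ηy) (hηL : A.ηy * A.L ≤ 1 / 9) (t : ℕ) (w : Samples b S) :
    dualErr A.f A.Y (A.z (t + 1) w) ≤ (1 - A.ηy * A.μ) * dualErr A.f A.Y (A.z t w)
      + 2 * A.ηy * (A.L / A.μ) * A.L * consensusErr (A.z t w).x
      + 2 * A.ηy * ∑ i, inner ℝ ((A.z t w).y i - A.best (avg (A.z t w).x) i) (A.noiseY t w i)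
      + 2 * A.ηy ^ 2 * ∑ i, ‖A.noiseY t w i‖ ^ 2 - 3 / 8 * A.dualStep t w
      + 3 / (A.ηy * A.μ) * n * (A.L / A.μ) ^ 2 * A.ηx ^ 2 * ‖avg (A.z t w).g‖ ^ 2 := by
  have hμ := A.μ_pos
  have hm : 0 < A.ηy * A.μ := by positivity
  have hm1 : A.ηy * A.μ ≤ 1 := by
    have := mul_le_mul_of_nonneg_left A.μ_le_L hη.le
    linarith
  have e0 : 3 / (A.ηy * A.μ) * n * (A.L / A.μ) ^ 2 * A.ηx ^ 2 * ‖avg (A.z t w).g‖ ^ 2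
      = ∑ _i : Fin n, 3 / (A.ηy * A.μ) * ((A.L / A.μ) ^ 2 * A.ηx ^ 2 * ‖avg (A.z t w).g‖ ^ 2) := by
    simp
    ring
  rw [e0, dualErr, dualErr, consensusErr, dualStep]
  simp only [Finset.mul_sum]
  rw [← Finset.sum_add_distrib, ← Finset.sum_add_distrib, ← Finset.sum_add_distrib,
    ← Finset.sum_sub_distrib, ← Finset.sum_add_distrib]
  refine Finset.sum_le_sum fun i _ => ?_
  have h1 := (A.objective i).norm_sq_ascent_step_le hμ (A.convex i) (A.compact i) hη hηL
    (avg (A.z t w).x) ((A.z t w).x i) (A.y_mem t w i) (A.noiseY t w i)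
  have e1 : proj (A.Y i) ((A.z t w).y i + A.ηy •
      ((fullGrad (A.f i) ((A.z t w).x i) ((A.z t w).y i)).snd + A.noiseY t w i))
      = (A.z (t + 1) w).y i := by
    rw [z_succ_y, stochGrad_eq, WithLp.add_snd, noiseY, grad]
  rw [e1] at h1
  have h2 := norm_add_sq_le_young (half_pos hm)
    (argmaxOn (A.f i) (A.Y i) (avg (A.z t w).x) - (A.z (t + 1) w).y i)
    (A.best (avg (A.z (t + 1) w).x) i - A.best (avg (A.z t w).x) i)
  have e2 : argmaxOn (A.f i) (A.Y i) (avg (A.z t w).x) - (A.z (t + 1) w).y i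
      + (A.best (avg (A.z (t + 1) w).x) i - A.best (avg (A.z t w).x) i)
      = argmaxOn (A.f i) (A.Y i) (avg (A.z (t + 1) w).x) - (A.z (t + 1) w).y i := by
    rw [best, best]; abel
  rw [e2, norm_sub_rev (argmaxOn (A.f i) (A.Y i) (avg (A.z t w).x))] at h2
  have h3 := pow_le_pow_left₀ (norm_nonneg _)
    (A.norm_best_sub_le (avg (A.z (t + 1) w).x) (avg (A.z t w).x) i) 2
  have e3 : avg (A.z (t + 1) w).x - avg (A.z t w).x = -(A.ηx • avg (A.z t w).g) := by
    rw [avg_x_succ]; abel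
  rw [e3, norm_neg, norm_smul, mul_pow, mul_pow, Real.norm_eq_abs, sq_abs] at h3
  have h4 : (1 + 1 / (A.ηy * A.μ / 2)) * ‖A.best (avg (A.z (t + 1) w).x) i
      - A.best (avg (A.z t w).x) i‖ ^ 2
      ≤ 3 / (A.ηy * A.μ) * ((A.L / A.μ) ^ 2 * A.ηx ^ 2 * ‖avg (A.z t w).g‖ ^ 2) := by
    have h5 : 1 + 1 / (A.ηy * A.μ / 2) ≤ 3 / (A.ηy * A.μ) := by
      rw [le_div_iff₀ hm]
      field_simp
      linarith
    refine mul_le_mul h5 (h3.trans (le_of_eq (by ring))) (sq_nonneg _) (by positivity)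
  rw [best] at *
  linarith

/-- The displacement splits orthogonally into its mean $-\eta_x\bar g$ and its deviation from the
mean. -/
theorem sum_norm_sq_x_step_le (t : ℕ) (w : Samples b S) :
    ∑ i, ‖(A.z (t + 1) w).x i - (A.z t w).x i‖ ^ 2 ≤
      2 * consensusErr (A.z (t + 1) w).x + 2 * consensusErr (A.z t w).x
      + n * A.ηx ^ 2 * ‖avg (A.z t w).g‖ ^ 2 := by
  have h1 := consensusErr_eq A.mixing.pos ((A.z (t + 1) w).x - (A.z t w).x)
  have h2 := consensusErr_add_le one_pos (A.z (t + 1) w).x ((-1 : ℝ) • (A.z t w).x)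
  rw [consensusErr_smul, neg_one_smul, ← sub_eq_add_neg] at h2
  rw [avg_sub, avg_x_succ, sub_sub_cancel_left, norm_neg, norm_smul, mul_pow, Real.norm_eq_abs,
    sq_abs] at h1
  simp only [Pi.sub_apply] at h1
  linarith

/-- The change of the local primal gradients. -/
def gradStep (t : ℕ) (w : Samples b S) (i : Fin n) : Vec d :=
  (A.grad (t + 1) w i).fst - (A.grad t w i).fst

theorem sum_norm_sq_gradStep_le (t : ℕ) (w : Samples b S) :
    ∑ i, ‖A.gradStep t w i‖ ^ 2 ≤ 2 * A.L ^ 2 * (A.dualStep t w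
      + 2 * consensusErr (A.z (t + 1) w).x + 2 * consensusErr (A.z t w).x
      + n * A.ηx ^ 2 * ‖avg (A.z t w).g‖ ^ 2) := by
  have h1 : ∀ i, ‖A.gradStep t w i‖ ^ 2 ≤ 2 * A.L ^ 2 * (‖(A.z (t + 1) w).y i - (A.z t w).y i‖ ^ 2
      + ‖(A.z (t + 1) w).x i - (A.z t w).x i‖ ^ 2) := by
    intro i
    have h2 := (norm_fst_le_pair _).trans ((A.objective i).smooth ((A.z (t + 1) w).x i)
      ((A.z t w).x i) _ (A.y_mem (t + 1) w i) _ (A.y_mem t w i))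
    rw [WithLp.sub_fst] at h2
    refine (pow_le_pow_left₀ (norm_nonneg _) h2 2).trans ?_
    nlinarith [mul_nonneg (sq_nonneg A.L) (sq_nonneg (‖(A.z (t + 1) w).x i - (A.z t w).x i‖
      - ‖(A.z (t + 1) w).y i - (A.z t w).y i‖))]
  refine (Finset.sum_le_sum fun i _ => h1 i).trans ?_
  rw [← Finset.mul_sum, Finset.sum_add_distrib, ← dualStep]
  refine mul_le_mul_of_nonneg_left ?_ (by positivity)
  linarith [A.sum_norm_sq_x_step_le t w]

theorem z_succ_g_eq (t : ℕ) (w : Samples b S) : (A.z (t + 1) w).g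
    = mix A.W ((A.z t w).g - A.noiseX t w + A.gradStep t w + A.noiseX (t + 1) w) := by
  rw [z_succ_g]
  congr 1
  ext1 j
  have h1 := congrFun (A.stochGrad_fst t w) j
  have h2 := congrFun (A.stochGrad_fst (t + 1) w) j
  simp only [Pi.add_apply, Pi.sub_apply] at h1 h2 ⊢
  rw [h1, h2, gradStep]
  abel

end Scheme

set_option maxHeartbeats 1000000 in
/-- The weighted sum of the one-step inequalities. Here `Φ`, `X`, `δ`, `g` are the terms of the
Lyapunov function, primed after the step. -/
theorem weighted_sum_le {n A L μ η κ D Φ Φ' X X' δ δ' g g' P U y s Gb a₁ c₁ c₂ N : ℝ}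
    (hn : 0 < n) (hA : 0 < A) (hL : 0 < L) (hμ : 0 < μ) (hη : 0 < η) (hκ : κ = L / μ)
    (hκ1 : 1 ≤ κ) (hD : 0 < D) (hD1 : D ≤ 1) (hm1 : η * μ ≤ 1)
    (hA1 : A * (κ * L) ≤ D ^ 2 / 207)
    (hX0 : 0 ≤ X) (hδ0 : 0 ≤ δ) (hg0 : 0 ≤ g) (hy0 : 0 ≤ y) (hGb : 0 ≤ Gb)
    (hΦ : Φ' ≤ Φ - A / 2 * P - A / 2 * U + A * L ^ 2 / n * (X + δ) - A * a₁
      + κ * L * A ^ 2 * Gb)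
    (hX : X' ≤ (1 - D / 2) * X + 2 / D * A ^ 2 * g)
    (hδ : δ' ≤ (1 - η * μ) * δ + 2 * η * κ * L * X + 2 * η * c₁ + 2 * η ^ 2 * c₂ - 3 / 8 * y
      + 3 / (η * μ) * n * κ ^ 2 * A ^ 2 * Gb)
    (hg : g' ≤ (1 - D / 2) * g + N + 2 / D * s)
    (hs : s ≤ 2 * L ^ 2 * (y + 2 * X' + 2 * X + n * A ^ 2 * Gb)) :
    Φ' + 300 * κ ^ 2 * L ^ 2 * A / (n * D) * X' + 8 * A * L ^ 2 / (n * η * μ) * δ'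
      + 2400 * A ^ 3 * κ ^ 2 * L ^ 2 / (n * D ^ 3) * g' ≤
    Φ + 300 * κ ^ 2 * L ^ 2 * A / (n * D) * X + 8 * A * L ^ 2 / (n * η * μ) * δ
      + 2400 * A ^ 3 * κ ^ 2 * L ^ 2 / (n * D ^ 3) * g - A / 2 * P - A / 2 * U - A * a₁
      + (κ * L * A ^ 2 + 24 * A ^ 3 * L ^ 2 * κ ^ 2 / (η * μ) ^ 2 + A ^ 3 * L ^ 2 / 4) * Gb
      + 8 * A * L ^ 2 / (n * η * μ) * (2 * η * c₁ + 2 * η ^ 2 * c₂)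
      + 2400 * A ^ 3 * κ ^ 2 * L ^ 2 / (n * D ^ 3) * N := by
  have hκ0 : 0 < κ := by linarith
  have hm : 0 < η * μ := by positivity
  set c := A * L ^ 2 / n with hc
  have hc0 : 0 < c := by positivity
  set CX := 300 * κ ^ 2 * L ^ 2 * A / (n * D) with hCX
  set Cδ := 8 * A * L ^ 2 / (n * η * μ) with hCδ
  set Cg := 2400 * A ^ 3 * κ ^ 2 * L ^ 2 / (n * D ^ 3) with hCg
  set E := κ ^ 2 * c * A ^ 2 / D ^ 2 with hE
  have hCX0 : 0 ≤ CX := by positivity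
  have hCδ0 : 0 ≤ Cδ := by positivity
  have hCg0 : 0 ≤ Cg := by positivity
  -- The budget in units of `c` and `E`. For `X`: gain $150\kappa^2c$ against $16\kappa^2c+c+c$. For
  -- `δ`: $8c$ against $c$. For `g`: $1200E$ against $600E+E$. For `y`: at least $c$ against $c/4$.
  have i1 : CX * (D / 2) = 150 * κ ^ 2 * c := by rw [hCX, hc]; field_simp; norm_num
  have i2 : CX * (2 / D * A ^ 2) = 600 * E := by rw [hCX, hE, hc]; field_simp; norm_num
  have i3 : Cδ * (η * μ) = 8 * c := by rw [hCδ, hc]; field_simp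
  have i4 : Cδ * (2 * η * κ * L) = 16 * κ ^ 2 * c := by
    rw [hCδ, hc, hκ]; field_simp; norm_num
  have i5 : Cδ * (3 / (η * μ) * n * κ ^ 2 * A ^ 2) = 24 * A ^ 3 * L ^ 2 * κ ^ 2 / (η * μ) ^ 2 := by
    rw [hCδ]; field_simp; norm_num
  have i6 : Cg * (D / 2) = 1200 * E := by rw [hCg, hE, hc]; field_simp; norm_num
  have i7 : c ≤ Cδ * (3 / 8) := by
    have : Cδ * (3 / 8) = 3 * c / (η * μ) := by rw [hCδ, hc]; field_simp
    rw [this, le_div_iff₀ hm]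
    have := mul_le_mul_of_nonneg_left hm1 hc0.le
    linarith
  -- The constant 207 enters here through $9600/207^2\le1/4$.
  have i8 : Cg * (2 / D) * (2 * L ^ 2) ≤ c / 4 := by
    have h1 : Cg * (2 / D) * (2 * L ^ 2) = 9600 * (A * (κ * L)) ^ 2 / D ^ 4 * c := by
      rw [hCg, hc]; field_simp; norm_num
    have h2 : (A * (κ * L)) ^ 2 ≤ (D ^ 2 / 207) ^ 2 := pow_le_pow_left₀ (by positivity) hA1 2
    have h3 : 9600 * (A * (κ * L)) ^ 2 / D ^ 4 ≤ 1 / 4 := by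
      rw [div_le_iff₀ (by positivity)]
      have h4 : 0 < D ^ 4 := by positivity
      have h5 : (D ^ 2 / 207) ^ 2 = D ^ 4 / 42849 := by ring
      linarith
    rw [h1]
    exact (mul_le_mul_of_nonneg_right h3 hc0.le).trans (by linarith)
  have i9 : c * A ^ 2 / D ≤ E := by
    rw [hE, div_le_div_iff₀ hD (by positivity)]
    have h1 : 0 ≤ c * A ^ 2 * D := by positivity
    have h2 : D ≤ κ ^ 2 := hD1.trans (one_le_pow₀ hκ1)
    have h3 := mul_le_mul_of_nonneg_left h2 h1
    linarith
  have i10 : c / 4 * (n * A ^ 2) = A ^ 3 * L ^ 2 / 4 := by rw [hc]; field_simp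
  -- the change of the gradients
  have j1 : X' ≤ X + 2 / D * A ^ 2 * g := by linarith [mul_nonneg hD.le hX0]
  have j2 : 0 ≤ y + 4 * X + 4 / D * A ^ 2 * g + n * A ^ 2 * Gb := by positivity
  have j3 : Cg * (2 / D * s) ≤ c / 4 * (y + 4 * X + 4 / D * A ^ 2 * g + n * A ^ 2 * Gb) := by
    have h1 : s ≤ 2 * L ^ 2 * (y + 4 * X + 4 / D * A ^ 2 * g + n * A ^ 2 * Gb) := by
      refine hs.trans (mul_le_mul_of_nonneg_left ?_ (by positivity))
      have : 4 / D * A ^ 2 * g = 2 * (2 / D * A ^ 2 * g) := by ring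
      linarith
    have h2 := mul_le_mul_of_nonneg_left h1 (show 0 ≤ Cg * (2 / D) by positivity)
    have h3 := mul_le_mul_of_nonneg_right i8 j2
    linarith
  have j4 : c / 4 * (4 / D * A ^ 2 * g) ≤ E * g := by
    have h1 : c / 4 * (4 / D * A ^ 2 * g) = c * A ^ 2 / D * g := by ring
    rw [h1]
    exact mul_le_mul_of_nonneg_right i9 hg0
  have k1 := mul_le_mul_of_nonneg_left hX hCX0
  have k2 := mul_le_mul_of_nonneg_left hδ hCδ0
  have k3 := mul_le_mul_of_nonneg_left hg hCg0
  have l1 : CX * ((1 - D / 2) * X + 2 / D * A ^ 2 * g)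
      = CX * X - 150 * κ ^ 2 * c * X + 600 * E * g := by
    rw [← i1, ← i2]; ring
  have l2 : Cδ * ((1 - η * μ) * δ + 2 * η * κ * L * X + 2 * η * c₁ + 2 * η ^ 2 * c₂ - 3 / 8 * y
      + 3 / (η * μ) * n * κ ^ 2 * A ^ 2 * Gb)
      = Cδ * δ - 8 * c * δ + 16 * κ ^ 2 * c * X + Cδ * (2 * η * c₁ + 2 * η ^ 2 * c₂)
        - Cδ * (3 / 8) * y + 24 * A ^ 3 * L ^ 2 * κ ^ 2 / (η * μ) ^ 2 * Gb := by
    rw [← i3, ← i4, ← i5]; ring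
  have l3 : Cg * ((1 - D / 2) * g + N + 2 / D * s)
      = Cg * g - 1200 * E * g + Cg * N + Cg * (2 / D * s) := by
    rw [← i6]; ring
  rw [l1] at k1
  rw [l2] at k2
  rw [l3] at k3
  have m1 : c * y ≤ Cδ * (3 / 8) * y := mul_le_mul_of_nonneg_right i7 hy0
  have m2 : c * X ≤ κ ^ 2 * c * X := by
    have h1 : 1 ≤ κ ^ 2 := one_le_pow₀ hκ1
    have h2 := mul_le_mul_of_nonneg_right h1 (mul_nonneg hc0.le hX0)
    linarith
  have m3 : 0 ≤ E * g := by positivity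
  have m4 : 0 ≤ c * X := by positivity
  have m5 : 0 ≤ c * δ := by positivity
  have m6 : 0 ≤ c * y := by positivity
  have m7 : c / 4 * (n * A ^ 2 * Gb) = A ^ 3 * L ^ 2 / 4 * Gb := by rw [← i10]; ring
  linarith

/-- The weight of the squared mean gradient in `weighted_sum_le` is small. -/
theorem weight_le_half {A L μ η κ D : ℝ} (hA : 0 < A) (hL : 0 < L) (hμ : 0 < μ) (hη : 0 < η)
    (hκ : κ = L / μ) (hκ1 : 1 ≤ κ) (hD : 0 < D) (hD1 : D ≤ 1)
    (hA1 : A * (κ * L) ≤ D ^ 2 / 207) (hA2 : A * κ ^ 2 ≤ η / 19) :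
    κ * L * A ^ 2 + 24 * A ^ 3 * L ^ 2 * κ ^ 2 / (η * μ) ^ 2 + A ^ 3 * L ^ 2 / 4 ≤ A / 2 := by
  have h1 : A * (κ * L) ≤ 1 / 207 := by nlinarith
  have h2 : A * L ≤ 1 / 207 := by nlinarith [mul_pos hA hL]
  -- Substituting $L/\mu=\kappa$ exposes the ratio $A\kappa^2/\eta\le1/19$.
  have h3 : 24 * A ^ 3 * L ^ 2 * κ ^ 2 / (η * μ) ^ 2 = 24 * A * ((A * κ ^ 2) ^ 2 / η ^ 2) := by
    rw [hκ]; field_simp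
  have h4 : (A * κ ^ 2) ^ 2 / η ^ 2 ≤ 1 / 361 := by
    rw [div_le_iff₀ (by positivity)]
    have := pow_le_pow_left₀ (by positivity) hA2 2
    linarith
  have h5 : (A * L) ^ 2 ≤ 1 / 207 := by
    have := mul_pos hA hL
    nlinarith
  rw [h3]
  have e1 : κ * L * A ^ 2 = A * (A * (κ * L)) := by ring
  have e2 : A ^ 3 * L ^ 2 / 4 = A * ((A * L) ^ 2 / 4) := by ring
  have e3 : 24 * A * ((A * κ ^ 2) ^ 2 / η ^ 2) = A * (24 * ((A * κ ^ 2) ^ 2 / η ^ 2)) := by ring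
  rw [e1, e2, e3, ← mul_add, ← mul_add, show A / 2 = A * (1 / 2) by ring]
  refine mul_le_mul_of_nonneg_left ?_ hA.le
  linarith

namespace Scheme

variable {n d b : ℕ} {p : Fin n → ℕ} {S : Fin n → Type*} [∀ i, MeasurableSpace (S i)]
  (A : Scheme n d b p S)

/-! ### Expectations of the noise terms -/

theorem ignores_avg_x {t : ℕ} {k : ℕ × Fin n × Fin b} (hk : t ≤ k.1) :
    Ignores (fun w => avg (A.z t w).x) k := fun w v => by
  have := A.ignores_x hk w v
  simp only at this ⊢
  rw [this]

theorem ignores_meanGrad {t : ℕ} {k : ℕ × Fin n × Fin b} (hk : t ≤ k.1) :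
    Ignores (A.meanGrad t) k := fun w v => by
  rw [meanGrad, A.ignores_grad hk w v, meanGrad]

theorem memLp_avg_x (t : ℕ) : MemLp (fun w => avg (A.z t w).x) 2 A.law := memLp_avg (A.memLp_x t)

theorem memLp_meanGrad (t : ℕ) : MemLp (A.meanGrad t) 2 A.law :=
  memLp_avg fun i => memLp_pair_fst (A.memLp_grad t i)

theorem continuous_primalGrad : Continuous A.primalGrad := by
  have h : (0 : ℝ) ≤ A.L * (1 + A.L / A.μ) := by
    have := A.L_pos; have := A.μ_pos; positivity
  exact (LipschitzWith.of_dist_le_mul (K := ⟨_, h⟩) fun x x' => by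
    rw [dist_eq_norm, dist_eq_norm]; exact A.norm_primalGrad_sub_le x x').continuous

theorem continuous_best (i : Fin n) : Continuous fun x => A.best x i := by
  have h : (0 : ℝ) ≤ A.L / A.μ := by
    have := A.L_pos; have := A.μ_pos; positivity
  exact (LipschitzWith.of_dist_le_mul (K := ⟨_, h⟩) fun x x' => by
    rw [dist_eq_norm, dist_eq_norm]; exact A.norm_best_sub_le x x' i).continuous

theorem memLp_primalGrad (t : ℕ) : MemLp (fun w => A.primalGrad (avg (A.z t w).x)) 2 A.law := by
  have h1 : MemLp (fun w => ‖A.primalGrad 0‖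
      + A.L * (1 + A.L / A.μ) * ‖avg (A.z t w).x‖) 2 A.law :=
    (memLp_const ‖A.primalGrad 0‖).add ((A.memLp_avg_x t).norm.const_mul _)
  refine h1.mono (A.continuous_primalGrad.comp_aestronglyMeasurable (A.memLp_avg_x t).1)
    (Filter.Eventually.of_forall fun w => ?_)
  have h2 := A.norm_primalGrad_sub_le (avg (A.z t w).x) 0
  rw [sub_zero] at h2
  have h3 := norm_le_norm_add_norm_sub (A.primalGrad 0) (A.primalGrad (avg (A.z t w).x))
  rw [norm_sub_rev] at h3
  exact (h3.trans (add_le_add_right h2 _)).trans (le_abs_self _)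

theorem memLp_best (t : ℕ) (i : Fin n) :
    MemLp (fun w => A.best (avg (A.z t w).x) i) 2 A.law := by
  obtain ⟨C, hC⟩ := (A.compact i).isBounded.exists_norm_le
  exact MemLp.of_bound ((A.continuous_best i).comp_aestronglyMeasurable (A.memLp_avg_x t).1) C
    (Filter.Eventually.of_forall fun w => hC _ (A.best_mem _ i))

theorem expZero_inner_avg_noiseX {t : ℕ} {Z : Samples b S → Vec d}
    (hZ : MemLp Z 2 A.law) (hi : ∀ i j, Ignores Z (t, i, j)) :
    ExpZero A.law fun w => inner ℝ (Z w) (avg (A.noiseX t w)) := by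
  have h1 := (ExpZero.sum (s := Finset.univ) fun i _ =>
    A.expZero_inner_noiseX hZ (hi i)).const_mul (n : ℝ)⁻¹
  convert h1 using 2
  rw [avg, inner_smul_right, inner_sum]

theorem expZero_inner_primalGrad (t : ℕ) :
    ExpZero A.law fun w => inner ℝ (A.primalGrad (avg (A.z t w).x)) (avg (A.noiseX t w)) := by
  refine A.expZero_inner_avg_noiseX (A.memLp_primalGrad t) fun i j w v => ?_
  have := A.ignores_avg_x (k := (t, i, j)) le_rfl w v
  simp only at this
  rw [this]

theorem expZero_inner_meanGrad (t : ℕ) :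
    ExpZero A.law fun w => inner ℝ (A.meanGrad t w) (avg (A.noiseX t w)) :=
  A.expZero_inner_avg_noiseX (A.memLp_meanGrad t) fun _ _ => A.ignores_meanGrad le_rfl

theorem expZero_inner_dual (t : ℕ) : ExpZero A.law fun w =>
    ∑ i, inner ℝ ((A.z t w).y i - A.best (avg (A.z t w).x) i) (A.noiseY t w i) := by
  refine ExpZero.sum fun i _ => A.expZero_inner_noiseY ((A.memLp_y t i).sub (A.memLp_best t i))
    fun j w v => ?_
  have h1 := A.ignores_avg_x (k := (t, i, j)) le_rfl w v
  have h2 := A.ignores_y (k := (t, i, j)) le_rfl w v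
  simp only at h1 h2
  rw [h1, h2]

theorem expLE_sum_norm_sq_noiseX (t : ℕ) :
    ExpLE A.law (fun w => ∑ i, ‖A.noiseX t w i‖ ^ 2) (n * (A.σ ^ 2 / b)) := by
  simpa using ExpLE.sum (s := Finset.univ) fun i _ => A.expLE_norm_sq_noiseX t i

theorem expLE_sum_norm_sq_noiseY (t : ℕ) :
    ExpLE A.law (fun w => ∑ i, ‖A.noiseY t w i‖ ^ 2) (n * (A.σ ^ 2 / b)) := by
  simpa using ExpLE.sum (s := Finset.univ) fun i _ => A.expLE_norm_sq_noiseY t i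

/-- The entries of `W` are nonnegative, so the sign from `expLE_neg_inner_g_noiseX` survives both
mixings. -/
theorem expLE_neg_inner_mix_mix_g (t : ℕ) : ExpLE A.law (fun w =>
    -1 * ∑ i, inner ℝ (mix A.W (mix A.W (A.z t w).g) i) (A.noiseX t w i)) 0 := by
  have h1 := ExpLE.sum (s := Finset.univ) fun (i : Fin n) _ =>
    ExpLE.sum (s := Finset.univ) fun (j : Fin n) _ => ExpLE.const_mul (A.mixing.nonneg i j)
      (ExpLE.sum (s := Finset.univ) fun (k : Fin n) _ =>
        ExpLE.const_mul (A.mixing.nonneg j k) (A.expLE_neg_inner_g_noiseX t k i))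
  simp only [mul_zero, Finset.sum_const_zero] at h1
  convert h1 using 2
  rw [Finset.mul_sum]
  refine Finset.sum_congr rfl fun i _ => ?_
  rw [mix, sum_inner, Finset.mul_sum]
  refine Finset.sum_congr rfl fun j _ => ?_
  rw [inner_smul_left, mix, sum_inner, Finset.mul_sum, Finset.mul_sum, Finset.mul_sum]
  refine Finset.sum_congr rfl fun k _ => ?_
  rw [inner_smul_left, conj_trivial, conj_trivial]
  ring

/-- The tracking variables before the noise of the next iteration is added and averaged. -/
def tracked (t : ℕ) (w : Samples b S) : Fin n → Vec d :=
  (A.z t w).g - A.noiseX t w + A.gradStep t w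

theorem memLp_tracked (t : ℕ) (i : Fin n) : MemLp (fun w => A.tracked t w i) 2 A.law :=
  ((A.memLp_g t i).sub (A.memLp_noiseX t i)).add
    ((memLp_pair_fst (A.memLp_grad (t + 1) i)).sub (memLp_pair_fst (A.memLp_grad t i)))

/-- The exact gradients at time `t + 1` depend only on $x^{t+1}$ and $y^{t+1}$, which are determined
by samples up to time `t`. -/
theorem ignores_tracked {t : ℕ} {k : ℕ × Fin n × Fin b} (hk : t + 1 = k.1) :
    Ignores (A.tracked t) k := fun w v => by
  have hk' : t < k.1 := by omega
  have h1 : A.gradStep t (Function.update w k v) = A.gradStep t w := by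
    ext1 i
    rw [gradStep, A.ignores_grad hk.le w v, A.ignores_grad hk'.le w v, gradStep]
  rw [tracked, A.ignores_z hk' w v, A.ignores_noiseX_of_lt hk' w v, h1, tracked]

theorem expZero_inner_tracked (t : ℕ) : ExpZero A.law fun w =>
    ∑ i, inner ℝ (mix A.W (fun j => mix A.W (A.tracked t w) j - avg (A.tracked t w)) i)
      (A.noiseX (t + 1) w i) := by
  refine ExpZero.sum fun i _ => A.expZero_inner_noiseX ?_ fun j w v => ?_
  · exact memLp_mix A.W (v := fun w j => mix A.W (A.tracked t w) j - avg (A.tracked t w))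
      (fun j => (memLp_mix A.W (A.memLp_tracked t) j).sub (memLp_avg (A.memLp_tracked t))) i
  · rw [A.ignores_tracked (k := (t + 1, i, j)) rfl w v]

/-! ### Integrability of the Lyapunov function -/

theorem integrable_consensusErr {v : Samples b S → Fin n → Vec d}
    (hv : ∀ i, MemLp (fun w => v w i) 2 A.law) :
    Integrable (fun w => consensusErr (v w)) A.law :=
  integrable_finsetSum _ fun i _ => integrable_norm_sq_of_memLp ((hv i).sub (memLp_avg hv))

theorem integrable_dualErr (t : ℕ) :
    Integrable (fun w => dualErr A.f A.Y (A.z t w)) A.law :=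
  integrable_finsetSum _ fun i _ =>
    integrable_norm_sq_of_memLp ((A.memLp_best t i).sub (A.memLp_y t i))

theorem differentiable_primal : Differentiable ℝ (primal A.f A.Y) := fun x =>
  (A.hasGradientAt_primal x).differentiableAt

/-- Smoothness gives quadratic growth of $\Phi$ in both directions. -/
theorem integrable_primal (t : ℕ) :
    Integrable (fun w => primal A.f A.Y (avg (A.z t w).x)) A.law := by
  have hx := A.memLp_avg_x t
  have h1 : Integrable (fun w => |primal A.f A.Y 0| + ‖A.primalGrad 0‖ * ‖avg (A.z t w).x‖
      + A.L / A.μ * A.L * ‖avg (A.z t w).x‖ ^ 2) A.law :=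
    ((integrable_const _).add ((hx.integrable one_le_two).norm.const_mul _)).add
      ((integrable_norm_sq_of_memLp hx).const_mul _)
  refine h1.mono' (A.differentiable_primal.continuous.comp_aestronglyMeasurable hx.1)
    (Filter.Eventually.of_forall fun w => ?_)
  have h2 := A.abs_primal_sub_le 0 (avg (A.z t w).x)
  rw [sub_zero] at h2
  have h3 := abs_real_inner_le_norm (A.primalGrad 0) (avg (A.z t w).x)
  rw [Real.norm_eq_abs, abs_le]
  rw [abs_le] at h2 h3
  constructor <;> linarith [neg_abs_le (primal A.f A.Y 0), le_abs_self (primal A.f A.Y 0)]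

theorem integrable_norm_sq_primalGrad (t : ℕ) :
    Integrable (fun w => ‖A.primalGrad (avg (A.z t w).x)‖ ^ 2) A.law :=
  integrable_norm_sq_of_memLp (A.memLp_primalGrad t)

theorem integrable_lyapunov (Φstar L μ κ lam ηx ηy : ℝ) (t : ℕ) :
    Integrable (fun w => lyapunov A.f A.Y Φstar L μ κ lam ηx ηy (A.z t w)) A.law :=
  ((((A.integrable_primal t).sub (integrable_const _)).add
    ((A.integrable_consensusErr (A.memLp_x t)).const_mul _)).add
    ((A.integrable_dualErr t).const_mul _)).add
    ((A.integrable_consensusErr (A.memLp_g t)).const_mul _)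

/-! ### Descent of the Lyapunov function -/

/-- The noise in one step of the Lyapunov function, with weights `a`, `K`, `Cy`, `Cg` of the
noise in the primal function, the squared mean gradient, the dual error and the gradient
tracking error. -/
def noiseTerm (a K Cy Cg D : ℝ) (t : ℕ) (w : Samples b S) : ℝ :=
  a * inner ℝ (A.primalGrad (avg (A.z t w).x)) (avg (A.noiseX t w))
  + K * (2 * inner ℝ (A.meanGrad t w) (avg (A.noiseX t w)) + ‖avg (A.noiseX t w)‖ ^ 2)
  + Cy * (2 * A.ηy * ∑ i, inner ℝ ((A.z t w).y i - A.best (avg (A.z t w).x) i) (A.noiseY t w i)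
    + 2 * A.ηy ^ 2 * ∑ i, ‖A.noiseY t w i‖ ^ 2)
  + Cg * ((1 + D / 2) * (∑ i, ‖A.noiseX t w i‖ ^ 2 + n * ‖avg (A.noiseX t w)‖ ^ 2
      + 2 * n * inner ℝ (A.meanGrad t w) (avg (A.noiseX t w))
      + 2 * (-1 * ∑ i, inner ℝ (mix A.W (mix A.W (A.z t w).g) i) (A.noiseX t w i)))
    + 2 * ∑ i, inner ℝ (mix A.W (fun j => mix A.W (A.tracked t w) j - avg (A.tracked t w)) i)
      (A.noiseX (t + 1) w i)
    + (1 - D) * ∑ i, ‖A.noiseX (t + 1) w i‖ ^ 2)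

/-- The weight `a` may have any sign since its term has mean zero. The other groups are only bounded
above, hence the nonnegative weights. -/
theorem expLE_noiseTerm {a K Cy Cg D : ℝ} (hK : 0 ≤ K) (hCy : 0 ≤ Cy) (hCg : 0 ≤ Cg) (hD : 0 ≤ D)
    (hD1 : D ≤ 1) (t : ℕ) :
    ExpLE A.law (A.noiseTerm a K Cy Cg D t) (K * (A.σ ^ 2 / b / n)
      + Cy * (2 * A.ηy ^ 2 * (n * (A.σ ^ 2 / b)))
      + Cg * ((1 + D / 2) * (n * (A.σ ^ 2 / b) + n * (A.σ ^ 2 / b / n))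
        + (1 - D) * (n * (A.σ ^ 2 / b)))) := by
  have hn := A.n_pos.le
  have h1 := ((A.expZero_inner_primalGrad t).const_mul a).expLE
  have h2 := (((A.expZero_inner_meanGrad t).const_mul 2).expLE.add
    (A.expLE_norm_sq_avg_noiseX t)).const_mul hK
  have h3 := (((A.expZero_inner_dual t).const_mul (2 * A.ηy)).expLE.add
    ((A.expLE_sum_norm_sq_noiseY t).const_mul (show 0 ≤ 2 * A.ηy ^ 2 by positivity))).const_mul hCy
  have h4 := ((((A.expLE_sum_norm_sq_noiseX t).add
    ((A.expLE_norm_sq_avg_noiseX t).const_mul hn)).add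
    ((A.expZero_inner_meanGrad t).const_mul (2 * n)).expLE).add
    ((A.expLE_neg_inner_mix_mix_g t).const_mul zero_le_two)).const_mul
    (show 0 ≤ 1 + D / 2 by linarith)
  have h5 := ((h4.add ((A.expZero_inner_tracked t).const_mul 2).expLE).add
    ((A.expLE_sum_norm_sq_noiseX (t + 1)).const_mul (sub_nonneg.2 hD1))).const_mul hCg
  refine (((h1.add h2).add h3).add h5).mono (le_of_eq ?_)
  ring

theorem lyapunov_step_le {Φstar κ D : ℝ} (hκ : κ = A.L / A.μ)
    (hD : D = 1 - mixingRate A.W ^ 2) (hD0 : 0 < D) (hηx : 0 < A.ηx) (hηy : 0 < A.ηy)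
    (hηyL : A.ηy * A.L ≤ 1 / 9) (hA1 : A.ηx * (κ * A.L) ≤ D ^ 2 / 207)
    (hA2 : A.ηx * κ ^ 2 ≤ A.ηy / 19) (t : ℕ) (w : Samples b S) :
    lyapunov A.f A.Y Φstar A.L A.μ κ (mixingRate A.W) A.ηx A.ηy (A.z (t + 1) w) ≤
      lyapunov A.f A.Y Φstar A.L A.μ κ (mixingRate A.W) A.ηx A.ηy (A.z t w)
      - A.ηx / 2 * ‖A.primalGrad (avg (A.z t w).x)‖ ^ 2
      + A.noiseTerm (-A.ηx)
        (κ * A.L * A.ηx ^ 2 + 24 * A.ηx ^ 3 * A.L ^ 2 * κ ^ 2 / (A.ηy * A.μ) ^ 2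
          + A.ηx ^ 3 * A.L ^ 2 / 4)
        (8 * A.ηx * A.L ^ 2 / (n * A.ηy * A.μ))
        (2400 * A.ηx ^ 3 * κ ^ 2 * A.L ^ 2 / (n * D ^ 3)) D t w := by
  have hμ := A.μ_pos
  have hL := A.L_pos
  have hκ1 : 1 ≤ κ := by rw [hκ]; exact (one_le_div hμ).2 A.μ_le_L
  have hD1 : D ≤ 1 := by nlinarith [sq_nonneg (mixingRate A.W)]
  have hm1 : A.ηy * A.μ ≤ 1 := by
    have := mul_le_mul_of_nonneg_left A.μ_le_L hηy.le
    linarith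
  have hΦ := A.primal_step_le hηx.le t w
  have hX := A.mixing.consensusErr_x_step_le hD hD0 A.ηx (A.z t w).x (A.z t w).g
  rw [← z_succ_x] at hX
  have hδ := A.dual_step_le hηy hηyL t w
  have hg := A.mixing.consensusErr_g_step_le hD hD0 (A.z t w).g (A.noiseX t w) (A.gradStep t w)
    (A.noiseX (t + 1) w)
  rw [← z_succ_g_eq] at hg
  have hs := A.sum_norm_sq_gradStep_le t w
  have hδ0 : 0 ≤ dualErr A.f A.Y (A.z t w) := Finset.sum_nonneg fun _ _ => sq_nonneg _
  have hy0 : 0 ≤ A.dualStep t w := Finset.sum_nonneg fun _ _ => sq_nonneg _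
  rw [← hκ] at hΦ hδ
  have key := weighted_sum_le (N := (1 + D / 2) * (∑ i, ‖A.noiseX t w i‖ ^ 2
      - n * ‖avg (A.noiseX t w)‖ ^ 2 + 2 * (n * inner ℝ (avg (A.z t w).g) (avg (A.noiseX t w))
        - ∑ i, inner ℝ (mix A.W (mix A.W (A.z t w).g) i) (A.noiseX t w i)))
      + 2 * ∑ i, inner ℝ (mix A.W (fun j => mix A.W (A.tracked t w) j - avg (A.tracked t w)) i)
        (A.noiseX (t + 1) w i)
      + (1 - D) * ∑ i, ‖A.noiseX (t + 1) w i‖ ^ 2)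
    A.n_pos hηx hL hμ hηy hκ hκ1 hD0 hD1 hm1 hA1 (consensusErr_nonneg _)
    hδ0 (consensusErr_nonneg _) hy0 (sq_nonneg ‖avg (A.z t w).g‖) hΦ hX hδ
    (hg.trans (le_of_eq (by rw [tracked]; ring))) hs
  have hw := mul_le_mul_of_nonneg_right
    (weight_le_half hηx hL hμ hηy hκ hκ1 hD0 hD1 hA1 hA2) (sq_nonneg ‖A.meanGrad t w‖)
  -- The mean-gradient part is absorbed by `hw`; the rest goes into the noise.
  have e1 : ‖avg (A.z t w).g‖ ^ 2 = ‖A.meanGrad t w‖ ^ 2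
      + (2 * inner ℝ (A.meanGrad t w) (avg (A.noiseX t w)) + ‖avg (A.noiseX t w)‖ ^ 2) := by
    rw [avg_g, norm_add_sq_real]; ring
  -- Doubled and combined with $-n\|\bar\nu\|^2$, this leaves the $+n\|\bar\nu\|^2$ of `noiseTerm`.
  have e2 : inner ℝ (avg (A.z t w).g) (avg (A.noiseX t w))
      = inner ℝ (A.meanGrad t w) (avg (A.noiseX t w)) + ‖avg (A.noiseX t w)‖ ^ 2 := by
    rw [avg_g, inner_add_left, real_inner_self_eq_norm_sq]
  rw [e2, e1] at key
  rw [lyapunov, lyapunov, noiseTerm, ← hD]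
  linarith

/-- The constants match as $24+8=32$, $16\le24$ and $2400\cdot3=225\cdot32$. The last summand of the
bracket is slack. -/
theorem noise_bound_le {n A L μ η κ D s : ℝ} (hn : 1 ≤ n) (hA : 0 < A) (hL : 0 < L) (hμ : 0 < μ)
    (hη : 0 < η) (hκ : κ = L / μ) (hκ1 : 1 ≤ κ) (hD : 0 < D) (hm1 : η * μ ≤ 1)
    (hs : 0 ≤ s) :
    (κ * L * A ^ 2 + 24 * A ^ 3 * L ^ 2 * κ ^ 2 / (η * μ) ^ 2 + A ^ 3 * L ^ 2 / 4) * (s / n)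
      + 8 * A * L ^ 2 / (n * η * μ) * (2 * η ^ 2 * (n * s))
      + 2400 * A ^ 3 * κ ^ 2 * L ^ 2 / (n * D ^ 3) * ((1 + D / 2) * (n * s + n * (s / n))
        + (1 - D) * (n * s))
    ≤ A ^ 2 * L * κ * (s / n) + 24 * A * η * κ * L * s
      + (1 / (n * η ^ 2 * μ ^ 2) + 225 / D ^ 3 + 54 * A ^ 2 * κ ^ 2 * L ^ 2 / (n * D * η * μ))
        * (32 * A ^ 3 * κ ^ 2 * L ^ 2 * s) := by
  have hn0 : 0 < n := by linarith
  have hκ0 : 0 < κ := by linarith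
  have hm : 0 < η * μ := by positivity
  have h1 : A ^ 3 * L ^ 2 / 4 ≤ 8 * A ^ 3 * L ^ 2 * κ ^ 2 / (η * μ) ^ 2 := by
    have h2 : 1 ≤ κ ^ 2 / (η * μ) ^ 2 := by
      rw [one_le_div (by positivity)]
      exact pow_le_pow_left₀ hm.le (hm1.trans hκ1) 2
    have h3 : 0 < A ^ 3 * L ^ 2 := by positivity
    have h4 := mul_le_mul_of_nonneg_left h2 h3.le
    have e : 8 * A ^ 3 * L ^ 2 * κ ^ 2 / (η * μ) ^ 2
        = 8 * (A ^ 3 * L ^ 2 * (κ ^ 2 / (η * μ) ^ 2)) := by ring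
    rw [e]
    linarith
  have h2 := mul_le_mul_of_nonneg_right h1 (div_nonneg hs hn0.le)
  have e1 : 8 * A * L ^ 2 / (n * η * μ) * (2 * η ^ 2 * (n * s)) = 16 * (A * η * κ * L * s) := by
    rw [hκ]; field_simp; ring
  have h3 : 0 ≤ A * η * κ * L * s := by positivity
  have h4 : 2400 * A ^ 3 * κ ^ 2 * L ^ 2 / (n * D ^ 3) * ((1 + D / 2) * (n * s + n * (s / n))
        + (1 - D) * (n * s)) ≤ 225 / D ^ 3 * (32 * A ^ 3 * κ ^ 2 * L ^ 2 * s) := by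
    have h5 : (1 + D / 2) * (n * s + n * (s / n)) + (1 - D) * (n * s) ≤ 3 * n * s := by
      have e : n * (s / n) = s := by field_simp
      rw [e]
      have h6 : 0 ≤ (n - 1) * s := mul_nonneg (by linarith) hs
      have h7 := mul_nonneg hD.le h6
      linarith
    refine (mul_le_mul_of_nonneg_left h5 (by positivity)).trans (le_of_eq ?_)
    field_simp
    ring
  have h5 : 0 ≤ 54 * A ^ 2 * κ ^ 2 * L ^ 2 / (n * D * η * μ) * (32 * A ^ 3 * κ ^ 2 * L ^ 2 * s) := by
    positivity
  have e2 : 1 / (n * η ^ 2 * μ ^ 2) * (32 * A ^ 3 * κ ^ 2 * L ^ 2 * s)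
      = 24 * A ^ 3 * L ^ 2 * κ ^ 2 / (η * μ) ^ 2 * (s / n)
        + 8 * A ^ 3 * L ^ 2 * κ ^ 2 / (η * μ) ^ 2 * (s / n) := by
    field_simp; ring
  rw [e1]
  linarith

theorem integral_lyapunov_step_le {Φstar κ D : ℝ} (hκ : κ = A.L / A.μ)
    (hD : D = 1 - mixingRate A.W ^ 2) (hD0 : 0 < D) (hηx : 0 < A.ηx) (hηy : 0 < A.ηy)
    (hηyL : A.ηy * A.L ≤ 1 / 9) (hA1 : A.ηx * (κ * A.L) ≤ D ^ 2 / 207)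
    (hA2 : A.ηx * κ ^ 2 ≤ A.ηy / 19) (t : ℕ) :
    ∫ w, lyapunov A.f A.Y Φstar A.L A.μ κ (mixingRate A.W) A.ηx A.ηy (A.z (t + 1) w) ∂A.law ≤
      ∫ w, lyapunov A.f A.Y Φstar A.L A.μ κ (mixingRate A.W) A.ηx A.ηy (A.z t w) ∂A.law
      - A.ηx / 2 * ∫ w, ‖A.primalGrad (avg (A.z t w).x)‖ ^ 2 ∂A.law
      + (A.ηx ^ 2 * A.L * κ * (A.σ ^ 2 / b / n) + 24 * A.ηx * A.ηy * κ * A.L * (A.σ ^ 2 / b)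
      + (1 / (n * A.ηy ^ 2 * A.μ ^ 2) + 225 / D ^ 3
          + 54 * A.ηx ^ 2 * κ ^ 2 * A.L ^ 2 / (n * D * A.ηy * A.μ))
        * (32 * A.ηx ^ 3 * κ ^ 2 * A.L ^ 2 * (A.σ ^ 2 / b))) := by
  have hμ := A.μ_pos
  have hL := A.L_pos
  have hn := A.n_pos
  have hκ1 : 1 ≤ κ := by rw [hκ]; exact (one_le_div hμ).2 A.μ_le_L
  have hD1 : D ≤ 1 := by nlinarith [sq_nonneg (mixingRate A.W)]
  have hm1 : A.ηy * A.μ ≤ 1 := by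
    have := mul_le_mul_of_nonneg_left A.μ_le_L hηy.le
    linarith
  have hN := A.expLE_noiseTerm (a := -A.ηx)
    (K := κ * A.L * A.ηx ^ 2 + 24 * A.ηx ^ 3 * A.L ^ 2 * κ ^ 2 / (A.ηy * A.μ) ^ 2
      + A.ηx ^ 3 * A.L ^ 2 / 4)
    (Cy := 8 * A.ηx * A.L ^ 2 / (n * A.ηy * A.μ))
    (Cg := 2400 * A.ηx ^ 3 * κ ^ 2 * A.L ^ 2 / (n * D ^ 3))
    (by positivity) (by positivity) (by positivity) hD0.le hD1 t
  have hbound := hN.le.trans (noise_bound_le (by exact_mod_cast A.mixing.pos) hηx hL hμ hηy hκ hκ1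
    hD0 hm1 (by positivity))
  have hi := A.integrable_lyapunov Φstar A.L A.μ κ (mixingRate A.W) A.ηx A.ηy
  have hG := (A.integrable_norm_sq_primalGrad t).const_mul (A.ηx / 2)
  have hmono := integral_mono (hi (t + 1)) (((hi t).sub hG).add hN.integrable) fun w =>
    A.lyapunov_step_le (Φstar := Φstar) hκ hD hD0 hηx hηy hηyL hA1 hA2 t w
  rw [integral_add' ((hi t).sub hG) hN.integrable, integral_sub' (hi t) hG,
    integral_const_mul] at hmono
  linarith

end Scheme

/-! ### Passage to the sample laws, and the stepsizes -/

theorem IsOracle.map {d k : ℕ} {S Ω : Type*} [MeasurableSpace S] [MeasurableSpace Ω]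
    {P : Measure Ω} {φ : Vec d → Vec k → ℝ} {Y : Set (Vec k)} {σ : ℝ}
    {h : Vec d → Vec k → S → Pair d k} {ζ : Ω → S} (ho : IsOracle P φ Y σ h ζ)
    (hh : Measurable fun q : Vec d × Vec k × S => h q.1 q.2.1 q.2.2) (hζ : Measurable ζ) :
    IsOracle (P.map ζ) φ Y σ h id := by
  have hm : ∀ x y, Measurable fun v => h x y v := fun x y =>
    hh.comp (measurable_const.prodMk (measurable_const.prodMk measurable_id))
  refine ⟨fun x y hy => ?_, fun x y hy => ?_, fun x y hy => ?_⟩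
  · exact (memLp_map_measure_iff (hm x y).aestronglyMeasurable hζ.aemeasurable).2
      (ho.memLp x y hy)
  · simp only [id]
    rw [integral_map hζ.aemeasurable (hm x y).aestronglyMeasurable]
    exact ho.unbiased x y hy
  · have hm' : Measurable fun v => ‖h x y v - fullGrad φ x y‖ ^ 2 :=
      ((hm x y).sub measurable_const).norm.pow_const 2
    simp only [id]
    rw [integral_map hζ.aemeasurable hm'.aestronglyMeasurable]
    exact ho.variance x y hy

/-- The consequences of the stepsize conditions that are used. -/
theorem stepsize_bounds {L μ κ lam ηx ηy : ℝ} (hμ : 0 < μ) (hL : 0 < L) (hκ : κ = L / μ)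
    (hηy : 0 < ηy) (hηy_le : ηy ≤ √(1 - lam ^ 2) / (9 * (L + μ)))
    (hηx1 : ηx ≤ (1 - lam ^ 2) ^ 2 / (120 * √3 * κ * L)) (hηx : 0 < ηx)
    (hηx2 : ηx ≤ ηy / (8 * √6 * κ ^ 2)) :
    0 < 1 - lam ^ 2 ∧ ηy * L ≤ 1 / 9 ∧ ηx * (κ * L) ≤ (1 - lam ^ 2) ^ 2 / 207 ∧
      ηx * κ ^ 2 ≤ ηy / 19 := by
  have hκ0 : 0 < κ := by rw [hκ]; positivity
  refine ⟨?_, ?_, ?_, ?_⟩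
  -- If $1-\lambda^2\le0$, its real square root is zero, which contradicts $\eta_y>0$.
  · by_contra! h
    rw [Real.sqrt_eq_zero_of_nonpos h, zero_div] at hηy_le
    linarith
  · have h1 : √(1 - lam ^ 2) ≤ 1 :=
      (Real.sqrt_le_sqrt (by linarith [sq_nonneg lam])).trans_eq Real.sqrt_one
    rw [le_div_iff₀ (by positivity)] at hηy_le
    nlinarith [mul_pos hηy hμ]
  -- The integers come from $120\cdot1.73\ge207$ here and $8\cdot2.4\ge19$ below.
  · have h1 : (1.73 : ℝ) ≤ √3 := Real.le_sqrt_of_sq_le (by norm_num)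
    rw [le_div_iff₀ (by positivity)] at hηx1
    have h2 : 0 < ηx * (κ * L) := by positivity
    have h3 := mul_le_mul_of_nonneg_right h1 h2.le
    linarith
  · have h1 : (2.4 : ℝ) ≤ √6 := Real.le_sqrt_of_sq_le (by norm_num)
    rw [le_div_iff₀ (by positivity)] at hηx2
    have h2 : 0 < ηx * κ ^ 2 := by positivity
    have h3 := mul_le_mul_of_nonneg_right h1 h2.le
    linarith

end DSGTA
end

open DSGTA in
theorem mainTheorem2 {n d b : ℕ} {p : Fin n → ℕ} {S : Fin n → Type*}
    [∀ i, MeasurableSpace (S i)] {Ω : Type*} [MeasurableSpace Ω] (P : Measure Ω)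
    [IsProbabilityMeasure P] (hb : 0 < b)
    (G : SimpleGraph (Fin n)) (W : Matrix (Fin n) (Fin n) ℝ) (hW : IsMixing G W)
    (f : ∀ i, Vec d → Vec (p i) → ℝ) (Y : ∀ i, Set (Vec (p i)))
    (L μ σ Φstar : ℝ) (hμ : 0 < μ)
    (hf : ∀ i, IsSmoothStronglyConcave (f i) (Y i) L μ)
    (hYconvex : ∀ i, Convex ℝ (Y i)) (hYcompact : ∀ i, IsCompact (Y i))
    (hYdiam : ∀ i, 0 < Metric.diam (Y i))
    (hΦ : ∀ x, Φstar ≤ primal f Y x)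
    (h : ∀ i, Vec d → Vec (p i) → S i → Pair d (p i))
    (hmeas : ∀ i, Measurable fun q : Vec d × Vec (p i) × S i => h i q.1 q.2.1 q.2.2)
    (ξ : ℕ → ∀ i, Fin b → Ω → S i) (hξmeas : ∀ t i j, Measurable (ξ t i j))
    (hξindep : iIndepFun (β := fun k : ℕ × Fin n × Fin b => S k.2.1)
      (fun k => ξ k.1 k.2.1 k.2.2) P)
    (horacle : ∀ t i j, IsOracle P (f i) (Y i) σ (h i) (ξ t i j))
    (x₀ : Fin n → Vec d) (y₀ : ∀ i, Vec (p i)) (hy₀ : ∀ i, y₀ i ∈ Y i)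
    (κ lam ηx ηy : ℝ) (hκ : κ = L / μ) (hlam : lam = mixingRate W)
    (hηx : 0 < ηx) (hηy : 0 < ηy)
    (hηy_le : ηy ≤ √(1 - lam ^ 2) / (9 * (L + μ)))
    (hηx_le : ηx ≤ min ((1 - lam ^ 2) ^ 2 / (120 * √3 * κ * L))
      (min (ηy / (8 * √6 * κ ^ 2))
        ((ηy * μ) ^ (1 / 4 : ℝ) * (1 - lam ^ 2) / (50 * κ * L))))
    (z : ℕ → Ω → State n d p)
    (hz : ∀ t ω, z t ω = iterate h Y W ηx ηy x₀ y₀ (fun t i j => ξ t i j ω) t) :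
    Differentiable ℝ (primal f Y) ∧
    (∀ t, Integrable (fun ω => lyapunov f Y Φstar L μ κ lam ηx ηy (z t ω)) P) ∧
    (∀ t, Integrable (fun ω => ‖gradient (primal f Y) (avg (z t ω).x)‖ ^ 2) P) ∧
    ∀ t,
      ∫ ω, lyapunov f Y Φstar L μ κ lam ηx ηy (z (t + 1) ω) ∂P ≤
        ∫ ω, lyapunov f Y Φstar L μ κ lam ηx ηy (z t ω) ∂P
        - ηx / 2 * ∫ ω, ‖gradient (primal f Y) (avg (z t ω).x)‖ ^ 2 ∂P
        + ηx ^ 2 * L * κ * σ ^ 2 / (n * b)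
        + 24 * ηx * ηy * κ * L * σ ^ 2 / b
        + (1 / (n * ηy ^ 2 * μ ^ 2) + 225 / (1 - lam ^ 2) ^ 3
            + 54 * ηx ^ 2 * κ ^ 2 * L ^ 2 / (n * (1 - lam ^ 2) * ηy * μ))
          * (32 * ηx ^ 3 * κ ^ 2 * L ^ 2 * σ ^ 2 / b) := by
  have hprob : ∀ k : ℕ × Fin n × Fin b, IsProbabilityMeasure (P.map (ξ k.1 k.2.1 k.2.2)) :=
    fun k => Measure.isProbabilityMeasure_map (hξmeas _ _ _).aemeasurable
  let A : Scheme n d b p S :=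
    { f := f, Y := Y, L := L, μ := μ, σ := σ, ηx := ηx, ηy := ηy, G := G, W := W, h := h,
      x₀ := x₀, y₀ := y₀, ρ := fun k => P.map (ξ k.1 k.2.1 k.2.2), prob := hprob, b_pos := hb,
      μ_pos := hμ, mixing := hW, objective := hf, convex := hYconvex, compact := hYcompact,
      diam_pos := hYdiam, measurable_h := hmeas
      oracle := fun t i j => (horacle t i j).map (hmeas i) (hξmeas t i j), y₀_mem := hy₀ }
  let Ξ : Ω → Samples b S := fun ω k => ξ k.1 k.2.1 k.2.2 ω
  have hΞ : Measurable Ξ := measurable_pi_lambda _ fun k => hξmeas _ _ _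
  -- Mutual independence says exactly that the joint law of the samples is the product measure, so
  -- expectations can be computed on the product space.
  have hlaw : P.map Ξ = A.law :=
    hξindep.map_fun_eq_infinitePi_map fun k => hξmeas k.1 k.2.1 k.2.2
  have hzA : ∀ t ω, z t ω = A.z t (Ξ ω) := hz
  have hint : ∀ F : Samples b S → ℝ, Integrable F A.law →
      Integrable (fun ω => F (Ξ ω)) P ∧ ∫ ω, F (Ξ ω) ∂P = ∫ w, F w ∂A.law := by
    intro F hF
    rw [← hlaw] at hF ⊢
    exact ⟨(integrable_map_measure hF.1 hΞ.aemeasurable).1 hF,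
      (integral_map hΞ.aemeasurable hF.1).symm⟩
  have hV := fun t => hint _ (A.integrable_lyapunov Φstar L μ κ lam ηx ηy t)
  have hG := fun t => hint _ (A.integrable_norm_sq_primalGrad t)
  have hgrad : ∀ x, gradient (primal f Y) x = A.primalGrad x := A.gradient_primal
  simp only [hzA, hgrad]
  refine ⟨A.differentiable_primal, fun t => (hV t).1, fun t => (hG t).1, fun t => ?_⟩
  obtain ⟨hD, h1, h2, h3⟩ := stepsize_bounds hμ A.L_pos hκ hηy hηy_le
    (hηx_le.trans (min_le_left _ _)) hηx
    (hηx_le.trans ((min_le_right _ _).trans (min_le_left _ _)))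
  have key := A.integral_lyapunov_step_le (Φstar := Φstar) hκ (by rw [hlam]) hD hηx hηy h1 h2 h3 t
  rw [← show lam = mixingRate A.W from hlam] at key
  have e1 := (hV (t + 1)).2
  have e2 := (hV t).2
  have e3 := (hG t).2
  refine le_trans (e1.trans_le key) (le_of_eq ?_)
  rw [← e2, ← e3, div_div, mul_comm (b : ℝ) n]
  ring
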